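/- Let $(\Omega,\mathcal F,\mathbb P)$ be a probability space, $E$ a Polish space with its Borel $\sigma$-field, and $(X_t)_{t\in\mathbb Z}$ a stationary $E$-valued process. For $n\in\mathbb Z$ let $$\alpha(n)=\sup\{|\mathbb P(A\cap B)-\mathbb P(A)\mathbb P(B)| : A\in\sigma(X_t,\,t\le 0),\ B\in\sigma(X_t,\,t\ge n)\}$$ be its strong mixing coefficients, and assume that the process is $\alpha$-mixing, i.e. $\alpha(n)\to 0$ as $n\to\infty$. Let $\mathscr H$ be a separable real reproducing kernel Hilbert space of functions on $E$ with kernel $k$ and measurable feature map $\varphi(x)=k(x,\cdot)$, and assume $\sup_{x\in E}k(x,x)<\infty$. Let $S_2(\mathscr H)$ be the Hilbert space of Hilbert–Schmidt operators on $\mathscr H$, with norm $\|\cdot\|_{S_2(\mathscr H)}$; in any Hilbert space write $(y\otimes x)z=\langle z,x\rangle y$. For a time lag $\eta\in\mathbb N=\{0,1,2,\dots\}$ and $n\ge 1$ put $$C(\eta)=\mathbb E[\varphi(X_\eta)\otimes\varphi(X_0)]\in S_2(\mathscr H),\qquad C_n(\eta)=\frac1n\sum_{t=1}^n\varphi(X_{t+\eta})\otimes\varphi(X_t),$$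 $$\Gamma=\mathbb E\big[(\varphi(X_\eta)\otimes\varphi(X_0)-C(\eta))\otimes(\varphi(X_\eta)\otimes\varphi(X_0)-C(\eta))\big]\colon S_2(\mathscr H)\to S_2(\mathscr H).$$ (If $\mathbb E[\varphi(X_0)]=0$, then $C(\eta)$ is the kernel autocovariance operator of the process; centering is not required.) Let $(\lambda_j)_{j\ge 0}$ be the positive eigenvalues of $\Gamma$ in nonincreasing order, counted with multiplicities, followed by zeros if there are only finitely many. **Theorem.** Suppose there are constants $r\in(0,1)$ and $a>0$ such that $\alpha(t)\le a r^t$ and $\lambda_j<a r^j$ for all $t,j\in\mathbb N$. Then for every $\varepsilon>0$ there exist constants $k_1,k_2>0$, independent of $n$, such that for all $n\ge 1$ $$\mathbb P\big[\|C_n(\eta)-C(\eta)\|_{S_2(\mathscr H)}>\varepsilon\big]\le k_1\exp(-k_2 n^{1/3}).$$ Moreover, $\mathbb P$-almost surely, as $n\to\infty$, $$\|C_n(\eta)-C(\eta)\|_{S_2(\mathscr H)}=O\!\left(\frac{(\log n)^{3/2}}{n^{1/2}}\right).$$ -/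

import Mathlib

open MeasureTheory Filter Topology Asymptotics
open scoped InnerProductSpace

noncomputable section

namespace KernelAutocov

/-! ### The Hilbert space of Hilbert-Schmidt operators on a real Hilbert space -/

section HilbertSchmidt

variable (H : Type*) [NormedAddCommGroup H] [InnerProductSpace ℝ H] [CompleteSpace H]

/-- Index set of a fixed complete orthonormal system of `H`. -/
def basisIndex : Set H := (exists_hilbertBasis ℝ H).choose

/-- A fixed complete orthonormal system of `H`. -/
def basis : HilbertBasis (basisIndex H) ℝ H := (exists_hilbertBasis ℝ H).choose_spec.choose

/-- The linear subspace of bounded operators `A` with `∑ᵢ ‖A eᵢ‖² < ∞`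
(see `HilbertSchmidt.hasSum_norm_sq` for the independence of the basis). -/
def hilbertSchmidtSubmodule : Submodule ℝ (H →L[ℝ] H) where
  carrier := {A | Memℓp (fun i => A (basis H i)) 2}
  add_mem' := fun {A B} hA hB => by
    have h := Memℓp.add hA hB
    exact h
  zero_mem' := by
    have h := zero_memℓp (E := fun _ : basisIndex H => H) (p := 2)
    exact h
  smul_mem' := fun c A hA => by
    have h := Memℓp.const_smul hA c
    exact h

/-- The space `S₂(H)` of Hilbert-Schmidt operators on `H`. Its norm is the Hilbert-Schmidt norm
defined below, not the operator norm. -/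
def HilbertSchmidt : Type _ := hilbertSchmidtSubmodule H

instance : AddCommGroup (HilbertSchmidt H) := inferInstanceAs (AddCommGroup (hilbertSchmidtSubmodule H))

instance : Module ℝ (HilbertSchmidt H) := inferInstanceAs (Module ℝ (hilbertSchmidtSubmodule H))

namespace HilbertSchmidt

/-- The underlying bounded operator of a Hilbert-Schmidt operator. -/
def toCLM : HilbertSchmidt H →ₗ[ℝ] (H →L[ℝ] H) := (hilbertSchmidtSubmodule H).subtype

lemma toCLM_injective : Function.Injective (toCLM H) :=
  (hilbertSchmidtSubmodule H).injective_subtype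

variable {H} in
lemma memLp_basis (A : HilbertSchmidt H) : Memℓp (fun i => toCLM H A (basis H i)) 2 := A.2

/-- The map `A ↦ (A eᵢ)ᵢ` into the `ℓ²`-sum of copies of `H`. -/
def toLp : HilbertSchmidt H →ₗ[ℝ] lp (fun _ : basisIndex H => H) 2 where
  toFun A := ⟨fun i => toCLM H A (basis H i), memLp_basis A⟩
  map_add' A B := by ext i; simp; rfl
  map_smul' c A := by ext i; simp

lemma toLp_apply (A : HilbertSchmidt H) (i : basisIndex H) :
    toLp H A i = toCLM H A (basis H i) := rfl

lemma toLp_injective : Function.Injective (toLp H) := by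
  intro A B h
  apply toCLM_injective H
  have hd : Dense ((Submodule.span ℝ (Set.range (basis H)) : Submodule ℝ H) : Set H) :=
    Submodule.dense_iff_topologicalClosure_eq_top.2 (basis H).dense_span
  refine ContinuousLinearMap.ext_on hd ?_
  rintro _ ⟨i, rfl⟩
  rw [← toLp_apply, ← toLp_apply, h]

/-- The Hilbert-Schmidt norm `‖A‖ = (∑ᵢ ‖A eᵢ‖²)^(1/2)`. -/
instance : NormedAddCommGroup (HilbertSchmidt H) :=
  NormedAddCommGroup.induced (HilbertSchmidt H) (lp (fun _ : basisIndex H => H) 2) (toLp H)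
    (toLp_injective H)

variable {H} in
lemma norm_eq (A : HilbertSchmidt H) : ‖A‖ = ‖toLp H A‖ := rfl

/-- The Hilbert-Schmidt inner product `⟪A, B⟫ = ∑ᵢ ⟪A eᵢ, B eᵢ⟫ = tr (A* B)`. -/
instance : InnerProductSpace ℝ (HilbertSchmidt H) where
  norm_smul_le c A := by
    rw [norm_eq, norm_eq, map_smul]
    exact norm_smul_le c _
  inner A B := inner ℝ (toLp H A) (toLp H B)
  norm_sq_eq_re_inner A := norm_sq_eq_re_inner (𝕜 := ℝ) (toLp H A)
  conj_inner_symm A B := inner_conj_symm (toLp H A) (toLp H B)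
  add_left A B C := by
    simp only [map_add]
    exact inner_add_left _ _ _
  smul_left A B c := by
    simp only [map_smul]
    exact inner_smul_left _ _ _

variable {H} in
lemma inner_eq_tsum (A B : HilbertSchmidt H) :
    ⟪A, B⟫_ℝ = ∑' i, ⟪toCLM H A (basis H i), toCLM H B (basis H i)⟫_ℝ := rfl

set_option linter.unusedSectionVars false in
variable {H} in
lemma hasSum_inner_sq {ι : Type*} (b : HilbertBasis ι ℝ H) (x : H) :
    HasSum (fun i => ‖⟪b i, x⟫_ℝ‖ ^ 2) (‖x‖ ^ 2) := by
  have h := b.hasSum_inner_mul_inner x x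
  rw [real_inner_self_eq_norm_sq] at h
  refine h.congr_fun ?_
  intro i
  rw [real_inner_comm, Real.norm_eq_abs, sq_abs, sq]

lemma toLp_surjective : Function.Surjective (toLp H) := by
  intro f
  have key : ∀ x : H, ∃ C : ℝ, C ≤ ‖f‖ * ‖x‖ ∧
      HasSum (fun i => ‖⟪basis H i, x⟫_ℝ • f i‖) C := fun x => by
    have hf : HasSum (fun i => ‖f i‖ ^ (2 : ℝ)) (‖f‖ ^ (2 : ℝ)) := by
      simpa using lp.hasSum_norm (p := 2) (by simp) f
    have hx : HasSum (fun i => ‖⟪basis H i, x⟫_ℝ‖ ^ (2 : ℝ)) (‖x‖ ^ (2 : ℝ)) := by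
      simpa using hasSum_inner_sq (basis H) x
    obtain ⟨C, -, hC, hs⟩ := Real.inner_le_Lp_mul_Lq_hasSum_of_nonneg Real.HolderConjugate.two_two
      (norm_nonneg f) (norm_nonneg x) (fun i => norm_nonneg (f i))
      (fun i => norm_nonneg (⟪basis H i, x⟫_ℝ)) hf hx
    refine ⟨C, hC, hs.congr_fun fun i => ?_⟩
    rw [norm_smul, mul_comm]
  have hs : ∀ x : H, Summable fun i => ⟪basis H i, x⟫_ℝ • f i := fun x => by
    obtain ⟨C, -, h⟩ := key x
    exact h.summable.of_norm
  let L : H →ₗ[ℝ] H :=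
    { toFun := fun x => ∑' i, ⟪basis H i, x⟫_ℝ • f i
      map_add' := fun x y => by
        rw [← (hs x).tsum_add (hs y)]
        simp only [inner_add_right, add_smul]
      map_smul' := fun c x => by
        simp only [inner_smul_right, mul_smul, RingHom.id_apply]
        exact (hs x).tsum_const_smul c }
  let A : H →L[ℝ] H := L.mkContinuous ‖f‖ fun x => by
    obtain ⟨C, hC, h⟩ := key x
    refine (norm_tsum_le_tsum_norm h.summable).trans ?_
    rw [h.tsum_eq]
    exact hC
  have hA : ∀ j, A (basis H j) = f j := fun j => by
    change ∑' i, ⟪basis H i, basis H j⟫_ℝ • f i = f j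
    rw [tsum_eq_single j]
    · rw [real_inner_self_eq_norm_sq, (basis H).orthonormal.1 j]
      simp
    · intro i hij
      rw [(basis H).orthonormal.2 hij, zero_smul]
  have hmem : Memℓp (fun i => A (basis H i)) 2 := by
    simp only [hA]
    exact lp.memℓp f
  refine ⟨⟨A, hmem⟩, ?_⟩
  ext i
  exact hA i

instance : CompleteSpace (HilbertSchmidt H) := by
  let e : HilbertSchmidt H ≃ₗᵢ[ℝ] lp (fun _ : basisIndex H => H) 2 :=
    { LinearEquiv.ofBijective (toLp H) ⟨toLp_injective H, toLp_surjective H⟩ with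
      norm_map' := fun _ => rfl }
  exact (completeSpace_congr (e := e.toEquiv) e.isometry.isUniformEmbedding).2 inferInstance

variable {H} in
lemma tsum_ofReal_inner_sq {ι : Type*} (b : HilbertBasis ι ℝ H) (x : H) :
    ∑' i, ENNReal.ofReal (‖⟪b i, x⟫_ℝ‖ ^ 2) = ENNReal.ofReal (‖x‖ ^ 2) := by
  rw [← (hasSum_inner_sq b x).tsum_eq]
  exact (ENNReal.ofReal_tsum_of_nonneg (fun i => by positivity)
    (hasSum_inner_sq b x).summable).symm

variable {H} in
lemma tsum_ofReal_norm_sq_adjoint {ι κ : Type*} (b : HilbertBasis ι ℝ H) (d : HilbertBasis κ ℝ H)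
    (A : H →L[ℝ] H) : ∑' i, ENNReal.ofReal (‖A (b i)‖ ^ 2) =
      ∑' j, ENNReal.ofReal (‖A.adjoint (d j)‖ ^ 2) := by
  calc ∑' i, ENNReal.ofReal (‖A (b i)‖ ^ 2)
      = ∑' i, ∑' j, ENNReal.ofReal (‖⟪d j, A (b i)⟫_ℝ‖ ^ 2) := by
        simp only [tsum_ofReal_inner_sq d]
    _ = ∑' j, ∑' i, ENNReal.ofReal (‖⟪d j, A (b i)⟫_ℝ‖ ^ 2) := ENNReal.tsum_comm
    _ = ∑' j, ENNReal.ofReal (‖A.adjoint (d j)‖ ^ 2) := by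
      simp only [← tsum_ofReal_inner_sq b, ContinuousLinearMap.adjoint_inner_right, real_inner_comm]

variable {H} in
lemma hasSum_norm_sq_basis (A : HilbertSchmidt H) :
    HasSum (fun i => ‖toCLM H A (basis H i)‖ ^ 2) (‖A‖ ^ 2) := by
  simpa [toLp_apply, norm_eq] using lp.hasSum_norm (p := 2) (by simp) (toLp H A)

variable {H} in
/-- The Hilbert-Schmidt norm does not depend on the complete orthonormal system. -/
lemma hasSum_norm_sq {ι : Type*} (b : HilbertBasis ι ℝ H) (A : HilbertSchmidt H) :
    HasSum (fun i => ‖toCLM H A (b i)‖ ^ 2) (‖A‖ ^ 2) := by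
  have h1 := hasSum_norm_sq_basis A
  have h2 : ∑' i, ENNReal.ofReal (‖toCLM H A (b i)‖ ^ 2) = ENNReal.ofReal (‖A‖ ^ 2) := by
    rw [tsum_ofReal_norm_sq_adjoint b b, ← tsum_ofReal_norm_sq_adjoint (basis H) b, ← h1.tsum_eq]
    exact (ENNReal.ofReal_tsum_of_nonneg (fun i => by positivity) h1.summable).symm
  have h3 := ENNReal.hasSum_toReal (h2.trans_ne ENNReal.ofReal_ne_top)
  rw [← ENNReal.tsum_toReal_eq (fun _ => ENNReal.ofReal_ne_top), h2,
    ENNReal.toReal_ofReal (by positivity)] at h3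
  refine h3.congr_fun fun i => ?_
  rw [ENNReal.toReal_ofReal (by positivity)]

end HilbertSchmidt

variable {H}

/-- The rank-one operator `y ⊗ x : z ↦ ⟪z, x⟫ y` as a Hilbert-Schmidt operator. -/
def tensor (y x : H) : HilbertSchmidt H :=
  ⟨InnerProductSpace.rankOne ℝ y x, by
    refine (memℓp_gen_iff (by simp)).2 ?_
    have h := (HilbertSchmidt.hasSum_inner_sq (basis H) x).summable.mul_right (‖y‖ ^ 2)
    refine h.congr fun i => ?_
    simp [norm_smul, mul_pow, real_inner_comm]⟩

lemma tensor_apply (y x z : H) : HilbertSchmidt.toCLM H (tensor y x) z = ⟪z, x⟫_ℝ • y := by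
  rw [real_inner_comm]
  rfl

lemma norm_tensor (y x : H) : ‖tensor y x‖ = ‖y‖ * ‖x‖ := by
  have h1 := HilbertSchmidt.hasSum_norm_sq_basis (tensor y x)
  have h2 := (HilbertSchmidt.hasSum_inner_sq (basis H) x).mul_right (‖y‖ ^ 2)
  have h3 : ‖tensor y x‖ ^ 2 = (‖y‖ * ‖x‖) ^ 2 := by
    rw [mul_pow, mul_comm]
    refine h1.unique (h2.congr_fun fun i => ?_)
    simp [tensor_apply, norm_smul, mul_pow]
  exact (sq_eq_sq₀ (norm_nonneg _) (by positivity)).1 h3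

end HilbertSchmidt

/-! ### Eigenvalues of operators -/

/-- `l` lists the positive eigenvalues of the operator `T` in nonincreasing order and repeated
according to their multiplicities (followed by zeros if there are only finitely many). For a
positive semidefinite compact operator exactly one such sequence exists. -/
def IsEigenvalueSequence {F : Type*} [NormedAddCommGroup F] [InnerProductSpace ℝ F]
    (T : F →L[ℝ] F) (l : ℕ → ℝ) : Prop :=
  Antitone l ∧ (∀ j, 0 ≤ l j) ∧
    ∀ s : ℝ, 0 < s → {j | l j = s}.encard =
      Cardinal.toENat (Module.rank ℝ (Module.End.eigenspace (T : F →ₗ[ℝ] F) s))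

/-! ### Stationary processes and strong mixing coefficients -/

section Mixing

variable {Ω E : Type*} [MeasurableSpace Ω] [MeasurableSpace E]

/-- Stationarity: all finite-dimensional laws are invariant under time shifts. -/
def IsStationary (X : ℤ → Ω → E) (P : Measure Ω) : Prop :=
  ∀ (r : ℕ) (t : Fin r → ℤ) (η : ℕ),
    P.map (fun ω i => X (t i) ω) = P.map (fun ω i => X (t i + η) ω)

/-- `α(F₁, F₂) = sup {|P(A ∩ B) - P(A) P(B)| : A ∈ F₁, B ∈ F₂}`. -/
def alphaCoeff (P : Measure Ω) (F₁ F₂ : MeasurableSpace Ω) : ℝ :=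
  sSup {x : ℝ | ∃ A B : Set Ω, MeasurableSet[F₁] A ∧ MeasurableSet[F₂] B ∧
    x = |P.real (A ∩ B) - P.real A * P.real B|}

/-- The σ-field generated by the variables `X t` with `t ∈ I`. -/
@[reducible] def sigmaField (X : ℤ → Ω → E) (I : Set ℤ) : MeasurableSpace Ω :=
  ⨆ t ∈ I, MeasurableSpace.comap (X t) inferInstance

/-- The strong mixing coefficient `α(n) = α(σ(X t, t ≤ 0), σ(X t, t ≥ n))`. -/
def mixingCoeff (X : ℤ → Ω → E) (P : Measure Ω) (n : ℤ) : ℝ :=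
  alphaCoeff P (sigmaField X (Set.Iic 0)) (sigmaField X (Set.Ici n))

/-- Strong mixing (`α`-mixing). -/
def IsAlphaMixing (X : ℤ → Ω → E) (P : Measure Ω) : Prop :=
  Tendsto (mixingCoeff X P) atTop (𝓝 0)

end Mixing

/-! ### Kernel autocovariance operators -/

section KernelOperators

variable {E : Type*} (H : Type*) [NormedAddCommGroup H] [InnerProductSpace ℝ H] [CompleteSpace H]
  [RKHS ℝ H E ℝ]

/-- The reproducing kernel `k` of `H` as a real-valued function. -/
def kernel (x y : E) : ℝ := RKHS.kernel H x y 1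

/-- The canonical feature map `φ(x) = k(x, ·)`. -/
def feature (x : E) : H := RKHS.kerFun H x 1

lemma feature_apply (x y : E) : feature H x y = kernel H y x := RKHS.kerFun_apply H x 1 y

lemma inner_feature (f : H) (x : E) : ⟪f, feature H x⟫_ℝ = f x := by
  simp [feature]

lemma kernel_eq_inner (x y : E) : kernel H x y = ⟪feature H x, feature H y⟫_ℝ := by
  rw [real_inner_comm, inner_feature, feature_apply]

variable {Ω : Type*} [MeasurableSpace Ω]

/-- The kernel cross-covariance operator
`E[(φ(Y) - E φ(Y)) ⊗ (φ(X) - E φ(X))]` (Bochner expectations). -/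
def crossCov (P : Measure Ω) (Y X : Ω → E) : HilbertSchmidt H :=
  ∫ ω, tensor (feature H (Y ω) - ∫ ω', feature H (Y ω') ∂P)
    (feature H (X ω) - ∫ ω', feature H (X ω') ∂P) ∂P

/-- The (uncentered) kernel autocovariance operator `C(η) = E[φ(X_η) ⊗ φ(X_0)]`. -/
def autocov (P : Measure Ω) (X : ℤ → Ω → E) (η : ℕ) : HilbertSchmidt H :=
  ∫ ω, tensor (feature H (X η ω)) (feature H (X 0 ω)) ∂P

/-- For a centered process `C(η)` is the cross-covariance operator of `X_η` and `X_0`. -/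
lemma crossCov_eq_autocov (P : Measure Ω) (X : ℤ → Ω → E)
    (hX : ∀ t, ∫ ω, feature H (X t ω) ∂P = 0) (η : ℕ) :
    crossCov H P (X η) (X 0) = autocov H P X η := by
  simp [crossCov, autocov, hX]

/-- The empirical autocovariance operator
`C_n(η) = (1/n) ∑_{t=1}^n φ(X_{t+η}) ⊗ φ(X_t)`. -/
def empAutocov (X : ℤ → Ω → E) (η n : ℕ) (ω : Ω) : HilbertSchmidt H :=
  (n : ℝ)⁻¹ • ∑ t ∈ Finset.Icc 1 n,
    tensor (feature H (X ((t : ℤ) + η) ω)) (feature H (X t ω))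

/-- The covariance operator
`Γ = E[(φ(X_η) ⊗ φ(X_0) - C(η)) ⊗ (φ(X_η) ⊗ φ(X_0) - C(η))]` on `S₂(H)`. -/
def covOp (P : Measure Ω) (X : ℤ → Ω → E) (η : ℕ) : HilbertSchmidt H →L[ℝ] HilbertSchmidt H :=
  ∫ ω, InnerProductSpace.rankOne ℝ
    (tensor (feature H (X η ω)) (feature H (X 0 ω)) - autocov H P X η)
    (tensor (feature H (X η ω)) (feature H (X 0 ω)) - autocov H P X η) ∂P

end KernelOperators

end KernelAutocov

end

/-!
The empirical operators are time averages of the bounded observable `(x, y) ↦ φ(y) ⊗ φ(x)`, with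
values in the Hilbert space of Hilbert-Schmidt operators, along the process of pairs
`(X t, X (t + η))`. This process is again identically distributed and strongly mixing at a geometric
rate (`isGeometricallyMixing_pair`), so both assertions are statements about sums of bounded
Hilbert-space valued observables of a geometrically mixing sequence. The constants in the estimates
below do not depend on the dimension of the Hilbert space.

Exponential bound. For a real observable with values in `[0, 1]` the sum up to `n` is split along
the residue classes modulo about `√n`. Within a class consecutive variables are about `√n` apart,
and for a small fixed tilt the Chernoff bound for independent variables survives the error due to
mixing. This gives a bound of order `exp (-k * √n)`
(`IsGeometricallyMixing.isExpSmall_sum_ge`), which is stronger than the one claimed. A vector-valued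
observable is approximated in `L¹` by a simple function. The simple function is a combination of
finitely many indicators, and the norm of the difference is again a bounded real observable
(`IsGeometricallyMixing.isExpSmall_norm_sum`).

Almost sure rate. For centered bounded `X` and `Y` with values in a Hilbert space, measurable with
respect to σ-fields with mixing coefficient `α`, one has `|E⟪X, Y⟫| ≤ 13 * K ^ 2 * √α`
(`abs_integral_inner_le`). Combining the coordinates with random signs reduces this to scalar
variables whose fourth moments are bounded independently of the dimension, and these may be
truncated. Hence the second moment of a sum of `n` terms is `O(n)`. An Ottaviani-type maximal
inequality, in which independence is replaced by a gap of logarithmic length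
(`IsGeometricallyMixing.measureReal_exists_lt_norm_sum_le`), and the Borel-Cantelli lemma along
powers of two yield `O(√n * log n)` for the partial sums
(`IsGeometricallyMixing.ae_isBigO_norm_sum`), again slightly more than needed.
-/

open MeasureTheory Filter Topology Asymptotics
open scoped InnerProductSpace

namespace KernelAutocov

/-! ### The covariance inequality for real random variables -/

section Covariance

variable {Ω : Type*} {𝓐 𝓑 : MeasurableSpace Ω} [mΩ : MeasurableSpace Ω] {P : Measure Ω}
  [IsProbabilityMeasure P] {α : ℝ}

/-- The set is the one on which the conditional expectation of `g` is positive. -/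
lemma exists_measurableSet_integral_mul_le (h𝓐 : 𝓐 ≤ mΩ) {f g : Ω → ℝ}
    (hf : StronglyMeasurable[𝓐] f) (hf0 : ∀ ω, 0 ≤ f ω) (hf1 : ∀ ω, f ω ≤ 1)
    (hg : Integrable g P) :
    ∃ A, MeasurableSet[𝓐] A ∧ ∫ ω, f ω * g ω ∂P ≤ ∫ ω in A, g ω ∂P := by
  have hh : StronglyMeasurable[𝓐] (P[g|𝓐]) := stronglyMeasurable_condExp
  have hA : MeasurableSet[𝓐] {ω | 0 < (P[g|𝓐]) ω} :=
    @StronglyMeasurable.measurableSet_lt _ _ 𝓐 _ _ _ _ _ _ stronglyMeasurable_const hh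
  refine ⟨_, hA, ?_⟩
  have hfg : Integrable (f * g) P := hg.bdd_mul (c := 1) (hf.mono h𝓐).aestronglyMeasurable
    (.of_forall fun ω => by rw [Real.norm_eq_abs, abs_of_nonneg (hf0 ω)]; exact hf1 ω)
  have hfh : Integrable (fun ω => f ω * (P[g|𝓐]) ω) P :=
    integrable_condExp.bdd_mul (c := 1) (hf.mono h𝓐).aestronglyMeasurable
    (.of_forall fun ω => by rw [Real.norm_eq_abs, abs_of_nonneg (hf0 ω)]; exact hf1 ω)
  calc ∫ ω, f ω * g ω ∂P = ∫ ω, (P[f * g|𝓐]) ω ∂P := (integral_condExp h𝓐).symm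
    _ = ∫ ω, f ω * (P[g|𝓐]) ω ∂P :=
        integral_congr_ae (condExp_mul_of_stronglyMeasurable_left hf hfg hg)
    _ ≤ ∫ ω, Set.indicator {ω | 0 < (P[g|𝓐]) ω} (P[g|𝓐]) ω ∂P := by
        refine integral_mono hfh (integrable_condExp.indicator (h𝓐 _ hA)) fun ω => ?_
        simp only [Set.indicator_apply, Set.mem_ofPred_eq]
        split_ifs with h
        · exact mul_le_of_le_one_left h.le (hf1 ω)
        · exact mul_nonpos_of_nonneg_of_nonpos (hf0 ω) (not_lt.1 h)
    _ = ∫ ω in {ω | 0 < (P[g|𝓐]) ω}, (P[g|𝓐]) ω ∂P := integral_indicator (h𝓐 _ hA)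
    _ = _ := setIntegral_condExp h𝓐 hg hA

lemma integrable_of_abs_le {m : MeasurableSpace Ω} (hm : m ≤ mΩ) {f : Ω → ℝ} {M : ℝ}
    (hf : StronglyMeasurable[m] f) (hM : ∀ ω, |f ω| ≤ M) : Integrable f P :=
  .of_bound (hf.mono hm).aestronglyMeasurable M (.of_forall hM)

/-- Among `[0, 1]`-valued functions, indicators maximise the covariance: conditioning on one
σ-field at a time replaces each function by the indicator of the set where the conditional
expectation of its partner is positive. -/
lemma covariance_le_of_mem_unitInterval (h𝓐 : 𝓐 ≤ mΩ) (h𝓑 : 𝓑 ≤ mΩ)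
    (hα : ∀ A B, MeasurableSet[𝓐] A → MeasurableSet[𝓑] B →
      |P.real (A ∩ B) - P.real A * P.real B| ≤ α)
    {f g : Ω → ℝ} (hf : StronglyMeasurable[𝓐] f) (hf0 : ∀ ω, 0 ≤ f ω) (hf1 : ∀ ω, f ω ≤ 1)
    (hg : StronglyMeasurable[𝓑] g) (hg0 : ∀ ω, 0 ≤ g ω) (hg1 : ∀ ω, g ω ≤ 1) :
    ∫ ω, f ω * g ω ∂P - (∫ ω, f ω ∂P) * ∫ ω, g ω ∂P ≤ α := by
  have hfi : Integrable f P := integrable_of_abs_le h𝓐 hf (M := 1)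
    fun ω => by rw [abs_of_nonneg (hf0 ω)]; exact hf1 ω
  have hgi : Integrable g P := integrable_of_abs_le h𝓑 hg (M := 1)
    fun ω => by rw [abs_of_nonneg (hg0 ω)]; exact hg1 ω
  have hfg : Integrable (fun ω => f ω * g ω) P :=
    hgi.bdd_mul (c := 1) (hf.mono h𝓐).aestronglyMeasurable
    (.of_forall fun ω => by rw [Real.norm_eq_abs, abs_of_nonneg (hf0 ω)]; exact hf1 ω)
  obtain ⟨A, hA, h1⟩ := exists_measurableSet_integral_mul_le h𝓐 hf hf0 hf1
    (hgi.sub (integrable_const (∫ ω, g ω ∂P)))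
  have hAi : Integrable (A.indicator (fun _ => (1 : ℝ))) P :=
    (integrable_const 1).indicator (h𝓐 _ hA)
  obtain ⟨B, hB, h2⟩ := exists_measurableSet_integral_mul_le h𝓑 hg hg0 hg1
    (hAi.sub (integrable_const (P.real A)))
  have e1 : ∫ ω, f ω * (g ω - ∫ ω, g ω ∂P) ∂P
      = ∫ ω, f ω * g ω ∂P - (∫ ω, f ω ∂P) * ∫ ω, g ω ∂P := by
    simp_rw [mul_sub]
    rw [integral_sub hfg (hfi.mul_const _), integral_mul_const]
  have hgA : Integrable (fun ω => g ω * A.indicator (fun _ => (1 : ℝ)) ω) P := by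
    refine (hgi.indicator (h𝓐 _ hA)).congr (.of_forall fun ω => ?_)
    by_cases h : ω ∈ A <;> simp [h]
  have e2 : ∫ ω in A, (g ω - ∫ ω, g ω ∂P) ∂P
      = ∫ ω, g ω * (A.indicator (fun _ => (1 : ℝ)) ω - P.real A) ∂P := by
    simp_rw [mul_sub]
    rw [integral_sub hgi.integrableOn (integrable_const _), setIntegral_const,
      integral_sub hgA (hgi.mul_const _), integral_mul_const, ← integral_indicator (h𝓐 _ hA),
      smul_eq_mul, mul_comm (P.real A)]
    congr 1
    refine integral_congr_ae (.of_forall fun ω => ?_)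
    by_cases h : ω ∈ A <;> simp [h]
  have e3 : ∫ ω in B, (A.indicator (fun _ => (1 : ℝ)) ω - P.real A) ∂P
      = P.real (A ∩ B) - P.real A * P.real B := by
    rw [integral_sub hAi.integrableOn (integrable_const _), setIntegral_const,
      integral_indicator_const _ (h𝓐 _ hA), measureReal_restrict_apply (h𝓐 _ hA), smul_eq_mul,
      smul_eq_mul, mul_one, mul_comm (P.real B)]
  simp only [Pi.sub_apply] at h1 h2
  rw [e1, e2] at h1
  rw [e3] at h2
  exact h1.trans (h2.trans ((le_abs_self _).trans (hα A B hA hB)))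

/-- The covariance inequality for bounded real functions. -/
lemma abs_covariance_le (h𝓐 : 𝓐 ≤ mΩ) (h𝓑 : 𝓑 ≤ mΩ)
    (hα : ∀ A B, MeasurableSet[𝓐] A → MeasurableSet[𝓑] B →
      |P.real (A ∩ B) - P.real A * P.real B| ≤ α)
    {f g : Ω → ℝ} {M : ℝ} (hM : 0 < M) (hf : StronglyMeasurable[𝓐] f) (hfM : ∀ ω, |f ω| ≤ M)
    (hg : StronglyMeasurable[𝓑] g) (hgM : ∀ ω, |g ω| ≤ M) :
    |∫ ω, f ω * g ω ∂P - (∫ ω, f ω ∂P) * ∫ ω, g ω ∂P| ≤ 4 * M ^ 2 * α := by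
  have hfi : Integrable f P := integrable_of_abs_le h𝓐 hf hfM
  -- the affine map carrying `[-M, M]` to `[0, 1]`, with either orientation for `g`
  have key : ∀ g : Ω → ℝ, StronglyMeasurable[𝓑] g → (∀ ω, |g ω| ≤ M) →
      ∫ ω, f ω * g ω ∂P - (∫ ω, f ω ∂P) * ∫ ω, g ω ∂P ≤ 4 * M ^ 2 * α := by
    intro g hg hgM
    have hgi : Integrable g P := integrable_of_abs_le h𝓑 hg hgM
    have hfg : Integrable (fun ω => f ω * g ω) P :=
      hgi.bdd_mul (c := M) (hf.mono h𝓐).aestronglyMeasurable (.of_forall hfM)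
    have h01 : ∀ x : ℝ, |x| ≤ M → 0 ≤ (x + M) / (2 * M) ∧ (x + M) / (2 * M) ≤ 1 := fun x hx => by
      obtain ⟨h1, h2⟩ := abs_le.1 hx
      exact ⟨div_nonneg (by linarith) (by linarith), (div_le_one (by linarith)).2 (by linarith)⟩
    have h := covariance_le_of_mem_unitInterval h𝓐 h𝓑 hα (f := fun ω => (f ω + M) / (2 * M))
      (g := fun ω => (g ω + M) / (2 * M))
      ((hf.add stronglyMeasurable_const).div stronglyMeasurable_const)
      (fun ω => (h01 _ (hfM ω)).1) (fun ω => (h01 _ (hfM ω)).2)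
      ((hg.add stronglyMeasurable_const).div stronglyMeasurable_const)
      (fun ω => (h01 _ (hgM ω)).1) (fun ω => (h01 _ (hgM ω)).2)
    have e : ∀ ω, (f ω + M) / (2 * M) * ((g ω + M) / (2 * M))
        = (4 * M ^ 2)⁻¹ * (f ω * g ω + M * f ω + M * g ω + M ^ 2) := fun ω => by
      field_simp; ring
    simp_rw [e] at h
    have i1 : Integrable (fun ω => f ω * g ω + M * f ω) P := hfg.add (hfi.const_mul M)
    have i2 : Integrable (fun ω => f ω * g ω + M * f ω + M * g ω) P := i1.add (hgi.const_mul M)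
    rw [integral_const_mul, integral_add i2 (integrable_const _),
      integral_add i1 (hgi.const_mul M), integral_add hfg (hfi.const_mul M), integral_div,
      integral_div, integral_add hfi (integrable_const _), integral_add hgi (integrable_const _),
      integral_const_mul, integral_const_mul, integral_const, integral_const] at h
    simp only [probReal_univ, one_smul] at h
    have h4 : 0 < 4 * M ^ 2 := by positivity
    rw [← div_le_iff₀' h4]
    refine le_of_eq_of_le ?_ h
    field_simp
    ring
  refine abs_le.2 ⟨?_, key g hg hgM⟩
  have h := key (fun ω => -g ω) hg.neg (fun ω => by rw [abs_neg]; exact hgM ω)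
  simp only [mul_neg, integral_neg] at h
  linarith

lemma exists_clamp_eq_mul {M : ℝ} (hM : 0 < M) (u : ℝ) :
    ∃ c, 0 ≤ c ∧ c ≤ 1 ∧ max (-M) (min u M) = c * u ∧ (c = 1 ∨ M ^ 2 ≤ u ^ 2) := by
  rcases le_total u M with h | h
  · rw [min_eq_left h]
    rcases le_total (-M) u with h' | h'
    · exact ⟨1, zero_le_one, le_rfl, by rw [max_eq_right h', one_mul], .inl rfl⟩
    · have hu : u < 0 := by linarith
      refine ⟨-M / u, div_nonneg_of_nonpos (by linarith) hu.le, (div_le_one_of_neg hu).2 h', ?_,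
        .inr (by nlinarith)⟩
      rw [max_eq_left h', div_mul_cancel₀ _ hu.ne]
  · have hu : 0 < u := by linarith
    refine ⟨M / u, by positivity, (div_le_one hu).2 h, ?_, .inr (by nlinarith)⟩
    rw [min_eq_right h, max_eq_right (by linarith), div_mul_cancel₀ _ hu.ne']

lemma abs_mul_sub_clamp_le {M : ℝ} (hM : 0 < M) (u v : ℝ) :
    |u * v - max (-M) (min u M) * max (-M) (min v M)| ≤ (u ^ 4 + v ^ 4) / M ^ 2 := by
  obtain ⟨c, hc0, hc1, hc, hcu⟩ := exists_clamp_eq_mul hM u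
  obtain ⟨d, hd0, hd1, hd, hdv⟩ := exists_clamp_eq_mul hM v
  have hcd : c * d ≤ 1 := mul_le_one₀ hc1 hd0 hd1
  have hcd0 : 0 ≤ c * d := mul_nonneg hc0 hd0
  rw [hc, hd, show u * v - c * u * (d * v) = (1 - c * d) * (u * v) by ring, abs_mul,
    abs_of_nonneg (by linarith), le_div_iff₀ (by positivity)]
  have huv : |u * v| ≤ (u ^ 2 + v ^ 2) / 2 := by
    rw [abs_le]; constructor <;> nlinarith [sq_nonneg (u + v), sq_nonneg (u - v)]
  have main : ∀ w : ℝ, (w = u ∨ w = v) → M ^ 2 ≤ w ^ 2 →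
      (1 - c * d) * |u * v| * M ^ 2 ≤ u ^ 4 + v ^ 4 := fun w hw h => by
    calc (1 - c * d) * |u * v| * M ^ 2 ≤ 1 * ((u ^ 2 + v ^ 2) / 2) * w ^ 2 := by
          gcongr; linarith
      _ ≤ u ^ 4 + v ^ 4 := by
          rcases hw with rfl | rfl
          · nlinarith [sq_nonneg (w ^ 2 - v ^ 2)]
          · nlinarith [sq_nonneg (w ^ 2 - u ^ 2)]
  rcases hcu with rfl | h
  · rcases hdv with rfl | h
    · simp; positivity
    · exact main v (.inr rfl) h
  · exact main u (.inl rfl) h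

lemma sq_sub_clamp_le {M : ℝ} (hM : 0 < M) (u : ℝ) :
    (u - max (-M) (min u M)) ^ 2 ≤ u ^ 4 / M ^ 2 := by
  obtain ⟨c, hc0, hc1, hc, hcu⟩ := exists_clamp_eq_mul hM u
  rw [hc, le_div_iff₀ (by positivity), show (u - c * u) ^ 2 = (1 - c) ^ 2 * u ^ 2 by ring]
  rcases hcu with rfl | h
  · simp; positivity
  · calc (1 - c) ^ 2 * u ^ 2 * M ^ 2 ≤ 1 * u ^ 2 * u ^ 2 := by gcongr; nlinarith
      _ = u ^ 4 := by ring

/-- Truncating at level `M` trades boundedness by `M` against fourth moments. -/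
lemma abs_integral_mul_le_of_truncation (h𝓐 : 𝓐 ≤ mΩ) (h𝓑 : 𝓑 ≤ mΩ)
    (hα : ∀ A B, MeasurableSet[𝓐] A → MeasurableSet[𝓑] B →
      |P.real (A ∩ B) - P.real A * P.real B| ≤ α)
    {u v : Ω → ℝ} {K M : ℝ} (hM : 0 < M) (hu : StronglyMeasurable[𝓐] u) (huK : ∀ ω, |u ω| ≤ K)
    (hv : StronglyMeasurable[𝓑] v) (hvK : ∀ ω, |v ω| ≤ K)
    (hu0 : ∫ ω, u ω ∂P = 0) (hv0 : ∫ ω, v ω ∂P = 0) :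
    |∫ ω, u ω * v ω ∂P| ≤ 4 * M ^ 2 * α +
      3 / (2 * M ^ 2) * ∫ ω, (u ω ^ 4 + v ω ^ 4) ∂P := by
  set T : ℝ → ℝ := fun x => max (-M) (min x M) with hT
  have hTc : Continuous T := by fun_prop
  have hTM : ∀ x, |T x| ≤ M := fun x =>
    abs_le.2 ⟨le_max_left _ _, max_le (by linarith) (min_le_right _ _)⟩
  have hTu : StronglyMeasurable[𝓐] (fun ω => T (u ω)) := hTc.comp_stronglyMeasurable hu
  have hTv : StronglyMeasurable[𝓑] (fun ω => T (v ω)) := hTc.comp_stronglyMeasurable hv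
  have ui : Integrable u P := integrable_of_abs_le h𝓐 hu huK
  have vi : Integrable v P := integrable_of_abs_le h𝓑 hv hvK
  have Tui : Integrable (fun ω => T (u ω)) P := integrable_of_abs_le h𝓐 hTu fun ω => hTM _
  have Tvi : Integrable (fun ω => T (v ω)) P := integrable_of_abs_le h𝓑 hTv fun ω => hTM _
  have uv : Integrable (fun ω => u ω * v ω) P :=
    vi.bdd_mul (c := K) (hu.mono h𝓐).aestronglyMeasurable (.of_forall huK)
  have Tuv : Integrable (fun ω => T (u ω) * T (v ω)) P :=
    Tvi.bdd_mul (c := M) (hTu.mono h𝓐).aestronglyMeasurable (.of_forall fun ω => hTM _)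
  have p4 : ∀ x : ℝ, |x| ≤ K → |x ^ 4| ≤ K ^ 4 := fun x hx => by
    rw [abs_pow]; gcongr
  have u4 : Integrable (fun ω => u ω ^ 4) P :=
    integrable_of_abs_le h𝓐 (hu.pow 4) fun ω => p4 _ (huK ω)
  have v4 : Integrable (fun ω => v ω ^ 4) P :=
    integrable_of_abs_le h𝓑 (hv.pow 4) fun ω => p4 _ (hvK ω)
  have hc := abs_covariance_le h𝓐 h𝓑 hα hM hTu (fun ω => hTM _) hTv (fun ω => hTM _)
  have hd : |∫ ω, (u ω * v ω - T (u ω) * T (v ω)) ∂P|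
      ≤ (∫ ω, u ω ^ 4 ∂P + ∫ ω, v ω ^ 4 ∂P) / M ^ 2 := by
    rw [← integral_add u4 v4, ← integral_div]
    have i : Integrable (fun ω => (u ω ^ 4 + v ω ^ 4) / M ^ 2) P := (u4.add v4).div_const _
    rw [← Real.norm_eq_abs]
    exact norm_integral_le_of_norm_le i
      (.of_forall fun ω => abs_mul_sub_clamp_le hM (u ω) (v ω))
  rw [integral_sub uv Tuv] at hd
  have hm : ∀ w : Ω → ℝ, Integrable w P → Integrable (fun ω => T (w ω)) P →
      Integrable (fun ω => w ω ^ 4) P → (∃ K, ∀ ω, |w ω| ≤ K) → ∫ ω, w ω ∂P = 0 →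
      (∫ ω, T (w ω) ∂P) ^ 2 ≤ (∫ ω, w ω ^ 4 ∂P) / M ^ 2 := by
    rintro w wi Twi w4 ⟨K, hK⟩ w0
    have e : (∫ ω, T (w ω) ∂P) ^ 2 = (∫ ω, (w ω - T (w ω)) ∂P) ^ 2 := by
      rw [integral_sub wi Twi, w0]; ring
    have wTi : Integrable (fun ω => (w ω - T (w ω)) ^ 2) P := by
      refine .of_bound ((wi.sub Twi).aestronglyMeasurable.pow 2) ((K + M) ^ 2) (.of_forall fun ω => ?_)
      simp only [norm_pow, Real.norm_eq_abs]
      gcongr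
      exact (abs_sub _ _).trans (add_le_add (hK ω) (hTM _))
    rw [e, ← integral_div]
    refine le_trans ?_ (integral_mono wTi (w4.div_const _) fun ω => sq_sub_clamp_le hM _)
    exact (even_two.convexOn_pow (𝕜 := ℝ)).map_integral_le (continuous_pow 2).continuousOn
      isClosed_univ (.of_forall fun _ => Set.mem_univ _) (wi.sub Twi) wTi
  have hmu := hm u ui Tui u4 ⟨K, huK⟩ hu0
  have hmv := hm v vi Tvi v4 ⟨K, hvK⟩ hv0
  rw [integral_add u4 v4]
  have e : 3 / (2 * M ^ 2) * (∫ ω, u ω ^ 4 ∂P + ∫ ω, v ω ^ 4 ∂P)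
      = (∫ ω, u ω ^ 4 ∂P + ∫ ω, v ω ^ 4 ∂P) / M ^ 2
        + ((∫ ω, u ω ^ 4 ∂P) / M ^ 2 + (∫ ω, v ω ^ 4 ∂P) / M ^ 2) / 2 := by
    field_simp; ring
  rw [e]
  have hmuv : |(∫ ω, T (u ω) ∂P) * ∫ ω, T (v ω) ∂P|
      ≤ ((∫ ω, u ω ^ 4 ∂P) / M ^ 2 + (∫ ω, v ω ^ 4 ∂P) / M ^ 2) / 2 := by
    refine le_trans ?_ (div_le_div_of_nonneg_right (add_le_add hmu hmv) zero_le_two)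
    rw [abs_le]
    constructor <;> nlinarith [sq_nonneg (∫ ω, T (u ω) ∂P + ∫ ω, T (v ω) ∂P),
      sq_nonneg (∫ ω, T (u ω) ∂P - ∫ ω, T (v ω) ∂P)]
  rw [abs_le] at *
  constructor <;> linarith [hd.1, hd.2, hc.1, hc.2, hmuv.1, hmuv.2]

end Covariance

/-! ### Averages over signs -/

section Rademacher

variable {ι : Type*} [DecidableEq ι]

/-- The signed sum `∑_{i ∈ T} ± x i`, with sign `+` exactly on `s`. -/
def signedSum {V : Type*} [AddCommGroup V] (T : Finset ι) (x : ι → V) (s : Finset ι) : V :=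
  ∑ i ∈ T, if i ∈ s then x i else -x i

variable {V : Type*} [AddCommGroup V]

lemma signedSum_insert_of_subset {T : Finset ι} {a : ι} (ha : a ∉ T) (x : ι → V) {s : Finset ι}
    (hs : s ⊆ T) : signedSum (insert a T) x s = signedSum T x s - x a := by
  rw [signedSum, Finset.sum_insert ha, if_neg fun h => ha (hs h), signedSum]
  abel

lemma signedSum_insert_insert {T : Finset ι} {a : ι} (ha : a ∉ T) (x : ι → V) (s : Finset ι) :
    signedSum (insert a T) x (insert a s) = signedSum T x s + x a := by
  rw [signedSum, Finset.sum_insert ha, if_pos (Finset.mem_insert_self _ _), signedSum, add_comm]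
  congr 1
  refine Finset.sum_congr rfl fun i hi => ?_
  have : i ≠ a := fun h => ha (h ▸ hi)
  simp [this]

lemma sum_powerset_insert_signedSum {T : Finset ι} {a : ι} (ha : a ∉ T) (x y : ι → ℝ)
    (F : ℝ → ℝ → ℝ) :
    ∑ s ∈ (insert a T).powerset, F (signedSum (insert a T) x s) (signedSum (insert a T) y s)
      = ∑ s ∈ T.powerset, (F (signedSum T x s - x a) (signedSum T y s - y a)
        + F (signedSum T x s + x a) (signedSum T y s + y a)) := by
  rw [Finset.sum_powerset_insert ha, Finset.sum_add_distrib]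
  congr 1
  · refine Finset.sum_congr rfl fun s hs => ?_
    rw [signedSum_insert_of_subset ha x (Finset.mem_powerset.1 hs),
      signedSum_insert_of_subset ha y (Finset.mem_powerset.1 hs)]
  · refine Finset.sum_congr rfl fun s _ => ?_
    rw [signedSum_insert_insert ha, signedSum_insert_insert ha]

/-- Averaging over all signs recovers the inner product. -/
lemma sum_signedSum_mul (T : Finset ι) (x y : ι → ℝ) :
    ∑ s ∈ T.powerset, signedSum T x s * signedSum T y s = 2 ^ T.card * ∑ i ∈ T, x i * y i := by
  induction T using Finset.induction_on with
  | empty => simp [signedSum]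
  | insert a T ha ih =>
    rw [sum_powerset_insert_signedSum ha x y (fun u v => u * v), Finset.card_insert_of_notMem ha,
      Finset.sum_insert ha]
    have e : ∀ s, (signedSum T x s - x a) * (signedSum T y s - y a)
        + (signedSum T x s + x a) * (signedSum T y s + y a)
        = 2 * (signedSum T x s * signedSum T y s) + 2 * (x a * y a) := fun s => by ring
    simp_rw [e]
    rw [Finset.sum_add_distrib, ← Finset.mul_sum, ih, Finset.sum_const, Finset.card_powerset,
      nsmul_eq_mul]
    push_cast
    ring

/-- The fourth-moment Khintchine inequality. -/
lemma sum_signedSum_pow_four_le (T : Finset ι) (x : ι → ℝ) :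
    ∑ s ∈ T.powerset, signedSum T x s ^ 4 ≤ 3 * 2 ^ T.card * (∑ i ∈ T, x i ^ 2) ^ 2 := by
  induction T using Finset.induction_on with
  | empty => simp [signedSum]
  | insert a T ha ih =>
    rw [sum_powerset_insert_signedSum ha x x (fun u _ => u ^ 4), Finset.card_insert_of_notMem ha,
      Finset.sum_insert ha]
    have e : ∀ s, (signedSum T x s - x a) ^ 4 + (signedSum T x s + x a) ^ 4
        = 2 * signedSum T x s ^ 4 + 12 * x a ^ 2 * (signedSum T x s * signedSum T x s)
          + 2 * x a ^ 4 := fun s => by ring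
    simp_rw [e]
    rw [Finset.sum_add_distrib, Finset.sum_add_distrib, ← Finset.mul_sum, ← Finset.mul_sum,
      sum_signedSum_mul, Finset.sum_const, Finset.card_powerset, nsmul_eq_mul]
    simp_rw [← sq]
    set σ := ∑ i ∈ T, x i ^ 2
    push_cast
    have : (0 : ℝ) ≤ 2 ^ T.card * x a ^ 4 := by positivity
    rw [pow_succ (2 : ℝ)]
    nlinarith

end Rademacher

/-! ### The covariance inequality in a Hilbert space -/

section HilbertCovariance

variable {Ω : Type*} {𝓐 𝓑 : MeasurableSpace Ω} [mΩ : MeasurableSpace Ω] {P : Measure Ω}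
  [IsProbabilityMeasure P] {α : ℝ}
  {F : Type*} [NormedAddCommGroup F] [InnerProductSpace ℝ F]

lemma inner_signedSum {ι : Type*} [DecidableEq ι] (T : Finset ι) (e : ι → F) (s : Finset ι)
    (x : F) : ⟪x, signedSum T e s⟫_ℝ = signedSum T (fun i => ⟪x, e i⟫_ℝ) s := by
  rw [signedSum, signedSum, inner_sum]
  refine Finset.sum_congr rfl fun i _ => ?_
  split_ifs
  · rfl
  · rw [inner_neg_right]

variable [CompleteSpace F]

/-- The coordinates of `X` and `Y` are combined with random signs. This keeps the inner product on
average, while the fourth moments of the signed sums are bounded independently of the number of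
coordinates. -/
lemma abs_sum_integral_inner_mul_inner_le (h𝓐 : 𝓐 ≤ mΩ) (h𝓑 : 𝓑 ≤ mΩ) (hα0 : 0 < α)
    (hα : ∀ A B, MeasurableSet[𝓐] A → MeasurableSet[𝓑] B →
      |P.real (A ∩ B) - P.real A * P.real B| ≤ α)
    {X Y : Ω → F} {K : ℝ} (hK : 0 < K) (hX : StronglyMeasurable[𝓐] X) (hXK : ∀ ω, ‖X ω‖ ≤ K)
    (hY : StronglyMeasurable[𝓑] Y) (hYK : ∀ ω, ‖Y ω‖ ≤ K)
    (hX0 : ∫ ω, X ω ∂P = 0) (hY0 : ∫ ω, Y ω ∂P = 0)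
    {ι : Type*} {e : ι → F} (he : Orthonormal ℝ e) (T : Finset ι) :
    |∫ ω, ∑ i ∈ T, ⟪X ω, e i⟫_ℝ * ⟪Y ω, e i⟫_ℝ ∂P| ≤ 13 * K ^ 2 * √α := by
  classical
  have hinner : ∀ {m : MeasurableSpace Ω} {Z : Ω → F} (w : F), StronglyMeasurable[m] Z →
      StronglyMeasurable[m] fun ω => ⟪Z ω, w⟫_ℝ := fun w hZ =>
    (continuous_id.inner continuous_const).comp_stronglyMeasurable hZ
  have hb : ∀ {Z : Ω → F} (w : F), (∀ ω, ‖Z ω‖ ≤ K) → ∀ ω, |⟪Z ω, w⟫_ℝ| ≤ K * ‖w‖ :=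
    fun w hZ ω => (abs_real_inner_le_norm _ _).trans (by gcongr; exact hZ ω)
  have hXi : Integrable X P := .of_bound (hX.mono h𝓐).aestronglyMeasurable K (.of_forall hXK)
  have hYi : Integrable Y P := .of_bound (hY.mono h𝓑).aestronglyMeasurable K (.of_forall hYK)
  have h0 : ∀ {Z : Ω → F} (w : F), Integrable Z P → ∫ ω, Z ω ∂P = 0 → ∫ ω, ⟪Z ω, w⟫_ℝ ∂P = 0 :=
    fun {Z} w hZ hZ0 => by
      simp_rw [real_inner_comm w]
      rw [integral_inner hZ, hZ0, inner_zero_right]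
  have hbessel : ∀ {Z : Ω → F}, (∀ ω, ‖Z ω‖ ≤ K) → ∀ ω, ∑ i ∈ T, ⟪Z ω, e i⟫_ℝ ^ 2 ≤ K ^ 2 := by
    intro Z hZ ω
    have h := he.sum_inner_products_le (s := T) (x := Z ω)
    simp only [Real.norm_eq_abs, sq_abs] at h
    simp_rw [real_inner_comm (e _)]
    exact h.trans (by gcongr; exact hZ ω)
  have i4 : ∀ {Z : Ω → F} (w : F), StronglyMeasurable Z →
      (∀ ω, ‖Z ω‖ ≤ K) → Integrable (fun ω => ⟪Z ω, w⟫_ℝ ^ 4) P := fun w hZ hZK =>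
    integrable_of_abs_le le_rfl ((hinner w hZ).pow 4) (M := (K * ‖w‖) ^ 4) fun ω => by
      rw [abs_pow]; gcongr; exact hb w hZK ω
  have h4 : ∀ {Z : Ω → F}, StronglyMeasurable Z → (∀ ω, ‖Z ω‖ ≤ K) →
      ∑ s ∈ T.powerset, ∫ ω, ⟪Z ω, signedSum T e s⟫_ℝ ^ 4 ∂P ≤ 3 * 2 ^ T.card * K ^ 4 := by
    intro Z hZ hZK
    rw [← integral_finsetSum _ fun s _ => i4 _ hZ hZK]
    have hle : ∀ ω, ∑ s ∈ T.powerset, ⟪Z ω, signedSum T e s⟫_ℝ ^ 4 ≤ 3 * 2 ^ T.card * K ^ 4 := by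
      intro ω
      simp_rw [inner_signedSum]
      refine (sum_signedSum_pow_four_le T _).trans ?_
      rw [show K ^ 4 = (K ^ 2) ^ 2 by ring]
      gcongr
      exact hbessel hZK ω
    refine (integral_mono (integrable_finsetSum _ fun s _ => i4 _ hZ hZK)
      (integrable_const _) hle).trans ?_
    simp
  set n : ℝ := 2 ^ T.card with hn
  have hn0 : 0 < n := by positivity
  have hs : 0 < √α := Real.sqrt_pos.2 hα0
  -- the truncation level `M` with `M ^ 2 = K ^ 2 / √α` balances the two error terms
  set M : ℝ := √(K ^ 2 / √α) with hM
  have hM0 : 0 < M := Real.sqrt_pos.2 (by positivity)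
  have hM2 : M ^ 2 = K ^ 2 / √α := Real.sq_sqrt (by positivity)
  have hXY : ∀ s, Integrable (fun ω => ⟪X ω, signedSum T e s⟫_ℝ * ⟪Y ω, signedSum T e s⟫_ℝ) P :=
    fun s => (integrable_of_abs_le h𝓑 (hinner _ hY) (hb _ hYK)).bdd_mul
      (c := K * ‖signedSum T e s‖) ((hinner _ hX).mono h𝓐).aestronglyMeasurable
      (.of_forall (hb _ hXK))
  have hmain : |n * ∫ ω, ∑ i ∈ T, ⟪X ω, e i⟫_ℝ * ⟪Y ω, e i⟫_ℝ ∂P|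
      ≤ n * (4 * M ^ 2 * α) + 3 / (2 * M ^ 2) * (6 * n * K ^ 4) := by
    rw [← integral_const_mul]
    simp_rw [hn, ← sum_signedSum_mul, ← inner_signedSum]
    rw [integral_finsetSum _ fun s _ => hXY s]
    refine (Finset.abs_sum_le_sum_abs _ _).trans ?_
    refine (Finset.sum_le_sum fun s _ => abs_integral_mul_le_of_truncation h𝓐 h𝓑 hα hM0
      (hinner _ hX) (hb _ hXK) (hinner _ hY) (hb _ hYK) (h0 _ hXi hX0) (h0 _ hYi hY0)).trans ?_
    rw [Finset.sum_add_distrib, Finset.sum_const, Finset.card_powerset, nsmul_eq_mul,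
      ← Finset.mul_sum]
    push_cast
    gcongr
    have e4 : ∀ s, ∫ ω, (⟪X ω, signedSum T e s⟫_ℝ ^ 4 + ⟪Y ω, signedSum T e s⟫_ℝ ^ 4) ∂P
        = ∫ ω, ⟪X ω, signedSum T e s⟫_ℝ ^ 4 ∂P + ∫ ω, ⟪Y ω, signedSum T e s⟫_ℝ ^ 4 ∂P :=
      fun s => integral_add (i4 _ (hX.mono h𝓐) hXK) (i4 _ (hY.mono h𝓑) hYK)
    simp_rw [e4]
    rw [Finset.sum_add_distrib]
    linarith [h4 (hX.mono h𝓐) hXK, h4 (hY.mono h𝓑) hYK]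
  rw [abs_mul, abs_of_pos hn0] at hmain
  refine le_of_mul_le_mul_left (hmain.trans_eq ?_) hn0
  rw [hM2]
  field_simp
  nlinarith [Real.sq_sqrt hα0.le]

/-- The covariance inequality for bounded centered random variables with values in a Hilbert space
of arbitrary dimension. The exponent `1/2` of the mixing coefficient is not optimal. -/
lemma abs_integral_inner_le (h𝓐 : 𝓐 ≤ mΩ) (h𝓑 : 𝓑 ≤ mΩ) (hα0 : 0 < α)
    (hα : ∀ A B, MeasurableSet[𝓐] A → MeasurableSet[𝓑] B →
      |P.real (A ∩ B) - P.real A * P.real B| ≤ α)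
    {X Y : Ω → F} {K : ℝ} (hK : 0 < K) (hX : StronglyMeasurable[𝓐] X) (hXK : ∀ ω, ‖X ω‖ ≤ K)
    (hY : StronglyMeasurable[𝓑] Y) (hYK : ∀ ω, ‖Y ω‖ ≤ K)
    (hX0 : ∫ ω, X ω ∂P = 0) (hY0 : ∫ ω, Y ω ∂P = 0) :
    |∫ ω, ⟪X ω, Y ω⟫_ℝ ∂P| ≤ 13 * K ^ 2 * √α := by
  -- a countable orthonormal basis of the closed span of the range of `X`
  let S : Submodule ℝ F := (Submodule.span ℝ (Set.range X)).topologicalClosure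
  have hSsep : TopologicalSpace.IsSeparable (S : Set F) :=
    (hX.isSeparable_range.span (R := ℝ)).closure
  have : TopologicalSpace.SeparableSpace S := hSsep.separableSpace
  have : CompleteSpace S := (Submodule.isClosed_topologicalClosure _).completeSpace_coe
  obtain ⟨w, b, hb⟩ := exists_hilbertBasis ℝ S
  have hcount : Countable w := by
    refine Pairwise.countable_of_isOpen_disjoint (s := fun i => Metric.ball (b i) (1 / 2))
      (fun i j hij => Metric.ball_disjoint_ball ?_) (fun _ => Metric.isOpen_ball)
      fun i => ⟨b i, Metric.mem_ball_self (by norm_num)⟩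
    have h := norm_sub_sq_real (b i) (b j)
    rw [b.orthonormal.1 i, b.orthonormal.1 j, b.orthonormal.2 hij] at h
    rw [dist_eq_norm]
    nlinarith [norm_nonneg (b i - b j)]
  let e : w → F := fun i => (b i : F)
  have he : Orthonormal ℝ e := b.orthonormal.comp_linearIsometry S.subtypeₗᵢ
  have hXS : ∀ ω, X ω ∈ S := fun ω =>
    Submodule.le_topologicalClosure _ (Submodule.subset_span ⟨ω, rfl⟩)
  have hexp : ∀ ω, HasSum (fun i => ⟪X ω, e i⟫_ℝ * ⟪Y ω, e i⟫_ℝ) ⟪X ω, Y ω⟫_ℝ := fun ω => by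
    have h := b.hasSum_inner_mul_inner ⟨X ω, hXS ω⟩ (S.orthogonalProjectionOnto (Y ω))
    simpa [e, S.inner_orthogonalProjectionOnto_eq_of_mem_left, real_inner_comm] using h
  have hlim : Tendsto (fun T : Finset w => ∫ ω, ∑ i ∈ T, ⟪X ω, e i⟫_ℝ * ⟪Y ω, e i⟫_ℝ ∂P) atTop
      (𝓝 (∫ ω, ⟪X ω, Y ω⟫_ℝ ∂P)) := by
    refine tendsto_integral_filter_of_dominated_convergence (fun _ => K ^ 2) (.of_forall fun T => ?_)
      (.of_forall fun T => .of_forall fun ω => ?_) (integrable_const _)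
      (.of_forall fun ω => hexp ω)
    · refine Finset.aestronglyMeasurable_fun_sum _ fun i _ => ?_
      exact ((hX.mono h𝓐).aestronglyMeasurable.inner aestronglyMeasurable_const).mul
        ((hY.mono h𝓑).aestronglyMeasurable.inner aestronglyMeasurable_const)
    · have hbes : ∀ z : F, ‖z‖ ≤ K → ∑ i ∈ T, ⟪z, e i⟫_ℝ ^ 2 ≤ K ^ 2 := by
        intro z hz
        have h := he.sum_inner_products_le (s := T) (x := z)
        simp only [Real.norm_eq_abs, sq_abs] at h
        simp_rw [real_inner_comm (e _)]
        exact h.trans (by gcongr)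
      rw [Real.norm_eq_abs]
      refine abs_le_of_sq_le_sq ((Finset.sum_mul_sq_le_sq_mul_sq T _ _).trans ?_) (by positivity)
      rw [sq (K ^ 2)]
      exact mul_le_mul (hbes _ (hXK ω)) (hbes _ (hYK ω))
        (Finset.sum_nonneg fun i _ => sq_nonneg _) (by positivity)
  exact le_of_tendsto hlim.abs (.of_forall fun T =>
    abs_sum_integral_inner_mul_inner_le h𝓐 h𝓑 hα0 hα hK hX hXK hY hYK hX0 hY0 he T)

end HilbertCovariance

/-! ### Large deviations of real-valued averages -/

lemma exists_sq_mul_pow_le {θ : ℝ} (h0 : 0 < θ) (h1 : θ < 1) :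
    ∃ K k : ℝ, 0 < K ∧ 0 < k ∧ ∀ s : ℕ, (s : ℝ) ^ 2 * θ ^ s ≤ K * Real.exp (-k * s) := by
  have hl : Real.log θ < 0 := Real.log_neg h0 h1
  set k := -Real.log θ / 2 with hk
  have hk0 : 0 < k := by linarith
  refine ⟨2 / k ^ 2, k, by positivity, hk0, fun s => ?_⟩
  have h2 : θ ^ s = Real.exp (-k * s) * Real.exp (-k * s) := by
    rw [← Real.exp_add, show -k * s + -k * s = s * Real.log θ by rw [hk]; ring, Real.exp_nat_mul,
      Real.exp_log h0]
  have h3 : (k * s) ^ 2 / 2 ≤ Real.exp (k * s) := by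
    have := Real.pow_div_factorial_le_exp (k * s) (by positivity) 2
    simpa using this
  have h4 : Real.exp (k * s) * Real.exp (-k * s) = 1 := by rw [← Real.exp_add]; simp
  rw [h2, ← mul_assoc]
  gcongr
  rw [le_div_iff₀ (by positivity)]
  nlinarith [Real.exp_pos (-k * s), mul_le_mul_of_nonneg_right h3 (Real.exp_pos (-k * s)).le]

section GeometricMixing

variable {Ω G : Type*} [mΩ : MeasurableSpace Ω] [MeasurableSpace G]

/-- The σ-field generated by the variables `W t` with `t ∈ I`, for a process indexed by `ℕ`. -/
@[reducible] def generatedField (W : ℕ → Ω → G) (I : Set ℕ) : MeasurableSpace Ω :=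
  ⨆ t ∈ I, MeasurableSpace.comap (W t) inferInstance

/-- A sequence of identically distributed random variables whose strong mixing coefficients are
bounded by `a * r ^ d` at distance `d`. Only the one-dimensional laws are required to be
stationary; the mixing bound is uniform in the position of the gap. -/
structure IsGeometricallyMixing (P : Measure Ω) (W : ℕ → Ω → G) (a r : ℝ) : Prop where
  measurable : ∀ t, Measurable (W t)
  map_eq : ∀ t, P.map (W t) = P.map (W 0)
  const_pos : 0 < a
  rate_pos : 0 < r
  rate_lt_one : r < 1
  mixing : ∀ k d A B, MeasurableSet[generatedField W (Set.Iic k)] A →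
    MeasurableSet[generatedField W (Set.Ici (k + d))] B →
    |P.real (A ∩ B) - P.real A * P.real B| ≤ a * r ^ d

/-- The probabilities of the events `A n` are bounded by `k₁ * exp (-k₂ * √n)`. -/
def IsExpSmall (P : Measure Ω) (A : ℕ → Set Ω) : Prop :=
  ∃ k₁ k₂ : ℝ, 0 < k₁ ∧ 0 < k₂ ∧ ∀ n : ℕ, 1 ≤ n → P.real (A n) ≤ k₁ * Real.exp (-k₂ * √n)

variable {P : Measure Ω} {W : ℕ → Ω → G} {a r : ℝ}

omit mΩ in
lemma measurable_generatedField {I : Set ℕ} {t : ℕ} (ht : t ∈ I) :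
    Measurable[generatedField W I] (W t) :=
  measurable_iff_comap_le.2 (le_iSup₂_of_le t ht le_rfl)

lemma generatedField_le (hW : ∀ t, Measurable (W t)) (I : Set ℕ) : generatedField W I ≤ mΩ :=
  iSup₂_le fun t _ => (hW t).comap_le

lemma IsExpSmall.mono [IsFiniteMeasure P] {A B : ℕ → Set Ω} (hB : IsExpSmall P B)
    (h : ∀ n, 1 ≤ n → A n ⊆ B n) : IsExpSmall P A := by
  obtain ⟨k₁, k₂, h1, h2, hB⟩ := hB
  exact ⟨k₁, k₂, h1, h2, fun n hn => (measureReal_mono (h n hn)).trans (hB n hn)⟩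

lemma IsExpSmall.union {A B : ℕ → Set Ω} (hA : IsExpSmall P A) (hB : IsExpSmall P B) :
    IsExpSmall P fun n => A n ∪ B n := by
  obtain ⟨k₁, k₂, h1, h2, hA⟩ := hA
  obtain ⟨l₁, l₂, h1', h2', hB⟩ := hB
  refine ⟨k₁ + l₁, min k₂ l₂, by positivity, lt_min h2 h2', fun n hn => ?_⟩
  refine (measureReal_union_le _ _).trans ((add_le_add (hA n hn) (hB n hn)).trans ?_)
  rw [add_mul]
  gcongr
  · exact min_le_left _ _
  · exact min_le_right _ _

namespace IsGeometricallyMixing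

lemma integral_comp (hW : IsGeometricallyMixing P W a r) {V : Type*} [NormedAddCommGroup V] [NormedSpace ℝ V] {h : G → V}
    (hh : StronglyMeasurable h) (t : ℕ) :
    ∫ ω, h (W t ω) ∂P = ∫ x, h x ∂(P.map (W 0)) := by
  rw [← hW.map_eq t, integral_map (hW.measurable t).aemeasurable hh.aestronglyMeasurable]

variable [IsProbabilityMeasure P]

/-- Along a residue class modulo `p` the variables are separated by gaps of length `p`, and the
expectation of a product nearly factorises. -/
lemma integral_prod_residueClass_le (hW : IsGeometricallyMixing P W a r) {g : G → ℝ} (hg : Measurable g) {M ρ : ℝ} (hM : 1 ≤ M)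
    (hg0 : ∀ x, 0 ≤ g x) (hgM : ∀ x, g x ≤ M) (hρ0 : 0 ≤ ρ) (hρ1 : ρ ≤ 1)
    (hgρ : ∫ x, g x ∂(P.map (W 0)) ≤ ρ) (p i n : ℕ) :
    ∫ ω, ∏ t ∈ (Finset.range n).filter (fun t => t % p = i), g (W t ω) ∂P
      ≤ ρ ^ ((Finset.range n).filter (fun t => t % p = i)).card
        + ((Finset.range n).filter (fun t => t % p = i)).card
          * M ^ ((Finset.range n).filter (fun t => t % p = i)).card * (a * r ^ p) := by
  have har : 0 ≤ a * r ^ p := mul_nonneg hW.const_pos.le (pow_nonneg hW.rate_pos.le _)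
  induction n with
  | zero => simp
  | succ n ih =>
    rw [Finset.range_add_one, Finset.filter_insert]
    split_ifs with hn
    · set T := (Finset.range n).filter (fun t => t % p = i) with hT
      have hnT : n ∉ T := by simp [hT]
      simp only [Finset.prod_insert hnT, Finset.card_insert_of_notMem hnT]
      set c := T.card
      have hgap : ∀ t ∈ T, t + p ≤ n := fun t ht => by
        simp only [hT, Finset.mem_filter, Finset.mem_range] at ht
        have h1 : n ≡ t [MOD p] := hn.trans ht.2.symm
        have h2 : p ∣ n - t := (Nat.modEq_iff_dvd' ht.1.le).1 h1.symm
        have := Nat.le_of_dvd (by omega) h2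
        omega
      have hgn : ∫ ω, g (W n ω) ∂P ≤ ρ := (hW.integral_comp hg.stronglyMeasurable n).trans_le hgρ
      have hMc : 0 < M ^ c := by positivity
      have hprod0 : ∀ ω, 0 ≤ ∏ t ∈ T, g (W t ω) := fun ω => Finset.prod_nonneg fun t _ => hg0 _
      have hprodM : ∀ ω, ∏ t ∈ T, g (W t ω) ≤ M ^ c := fun ω =>
        (Finset.prod_le_prod (fun t _ => hg0 _) fun t _ => hgM _).trans_eq (Finset.prod_const M)
      have hcov : ∫ ω, g (W n ω) * ∏ t ∈ T, g (W t ω) ∂P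
          ≤ (∫ ω, ∏ t ∈ T, g (W t ω) ∂P) * ∫ ω, g (W n ω) ∂P + M ^ c * M * (a * r ^ p) := by
        by_cases hpn : p ≤ n
        · have h := covariance_le_of_mem_unitInterval (P := P)
            (generatedField_le hW.measurable (Set.Iic (n - p)))
            (generatedField_le hW.measurable (Set.Ici (n - p + p)))
            (hW.mixing (n - p) p) (f := fun ω => (∏ t ∈ T, g (W t ω)) / M ^ c)
            (g := fun ω => g (W n ω) / M)
            ((Measurable.stronglyMeasurable (Finset.measurable_fun_prod _ fun t ht => hg.comp
              (measurable_generatedField (by have := hgap t ht; simp; omega)))).div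
                stronglyMeasurable_const)
            (fun ω => div_nonneg (hprod0 ω) hMc.le)
            (fun ω => (div_le_one hMc).2 (hprodM ω))
            ((Measurable.stronglyMeasurable (hg.comp
              (measurable_generatedField (by simp; omega)))).div stronglyMeasurable_const)
            (fun ω => div_nonneg (hg0 _) (by linarith))
            (fun ω => (div_le_one (by linarith)).2 (hgM _))
          simp only [div_mul_div_comm] at h
          rw [integral_div, integral_div, integral_div, div_mul_div_comm, ← sub_div,
            div_le_iff₀ (by positivity)] at h
          simp_rw [mul_comm (g (W n _))]
          linarith
        · have hTe : T = ∅ := by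
            refine Finset.eq_empty_of_forall_notMem fun t ht => ?_
            have := hgap t ht
            omega
          simp only [hTe, Finset.prod_empty, mul_one, integral_const, probReal_univ, smul_eq_mul,
            one_mul]
          nlinarith [mul_nonneg (mul_nonneg hMc.le (by linarith : 0 ≤ M)) har]
      refine hcov.trans ?_
      have hE0 : 0 ≤ ∫ ω, ∏ t ∈ T, g (W t ω) ∂P := integral_nonneg hprod0
      calc _ ≤ (ρ ^ c + c * M ^ c * (a * r ^ p)) * ρ + M ^ c * M * (a * r ^ p) := by
            gcongr
            exact integral_nonneg fun ω => hg0 _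
        _ = ρ ^ (c + 1) + (c * M ^ c * (a * r ^ p)) * ρ + M ^ (c + 1) * (a * r ^ p) := by ring
        _ ≤ ρ ^ (c + 1) + (c * M ^ c * (a * r ^ p)) * M + M ^ (c + 1) * (a * r ^ p) := by
            gcongr; linarith
        _ = _ := by push_cast; ring
    · exact ih

/-- The one-variable Chernoff bound, from `exp u ≤ 1 + u + u ^ 2` for `|u| ≤ 1`. -/
lemma integral_exponential_tilt_le (hW : IsGeometricallyMixing P W a r) {h : G → ℝ} (hh : Measurable h) (h0 : ∀ x, 0 ≤ h x)
    (h1 : ∀ x, h x ≤ 1) {ε lam : ℝ} (hlam0 : 0 < lam) (hlam1 : lam ≤ 1) (hlamε : lam ≤ ε / 2) :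
    ∫ x, Real.exp (lam * (h x - ∫ y, h y ∂(P.map (W 0)) - ε)) ∂(P.map (W 0))
      ≤ Real.exp (-(lam * ε / 2)) := by
  have : IsProbabilityMeasure (P.map (W 0)) :=
    Measure.isProbabilityMeasure_map (hW.measurable 0).aemeasurable
  set ν := P.map (W 0)
  set μ := ∫ y, h y ∂ν
  have hi : Integrable h ν := .of_bound hh.aestronglyMeasurable 1
    (.of_forall fun x => by rw [Real.norm_eq_abs, abs_of_nonneg (h0 x)]; exact h1 x)
  have hexp : ∀ x, Real.exp (lam * h x) ≤ 1 + lam * h x + lam ^ 2 := fun x => by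
    have hx : |lam * h x| ≤ 1 := by
      rw [abs_of_nonneg (mul_nonneg hlam0.le (h0 x))]
      exact mul_le_one₀ hlam1 (h0 x) (h1 x)
    have h2 := (abs_le.1 (Real.abs_exp_sub_one_sub_id_le hx)).2
    have h3 : (lam * h x) ^ 2 ≤ lam ^ 2 := by
      rw [mul_pow]
      exact mul_le_of_le_one_right (sq_nonneg _) (pow_le_one₀ (h0 x) (h1 x))
    linarith
  have hei : Integrable (fun x => Real.exp (lam * h x)) ν := by
    refine .of_bound (by fun_prop) (Real.exp lam) (.of_forall fun x => ?_)
    rw [Real.norm_eq_abs, Real.abs_exp]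
    gcongr
    exact mul_le_of_le_one_right hlam0.le (h1 x)
  have hI : ∫ x, Real.exp (lam * h x) ∂ν ≤ Real.exp (lam * μ + lam ^ 2) := by
    have i1 : Integrable (fun x => 1 + lam * h x) ν := (integrable_const 1).add (hi.const_mul lam)
    calc ∫ x, Real.exp (lam * h x) ∂ν ≤ ∫ x, (1 + lam * h x + lam ^ 2) ∂ν :=
          integral_mono hei (i1.add (integrable_const _)) hexp
      _ = lam * μ + lam ^ 2 + 1 := by
          rw [integral_add i1 (integrable_const _), integral_add (integrable_const _)
            (hi.const_mul _), integral_const_mul]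
          simp
          ring
      _ ≤ _ := Real.add_one_le_exp _
  have e : ∀ x, Real.exp (lam * (h x - μ - ε))
      = Real.exp (-(lam * (μ + ε))) * Real.exp (lam * h x) := fun x => by
    rw [← Real.exp_add]; ring_nf
  simp_rw [e]
  rw [integral_const_mul]
  refine (mul_le_mul_of_nonneg_left hI (Real.exp_pos _).le).trans ?_
  rw [← Real.exp_add]
  gcongr
  nlinarith

/-- Large deviations above the mean. The sum is split along the residue classes modulo
`p = ⌊√n⌋ + 1`: each class has about `√n` members at mutual distance about `√n`, which balances the
Chernoff bound for independent variables against the error due to mixing. -/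
lemma isExpSmall_sum_ge (hW : IsGeometricallyMixing P W a r) {h : G → ℝ} (hh : Measurable h) (h0 : ∀ x, 0 ≤ h x) (h1 : ∀ x, h x ≤ 1)
    {ε : ℝ} (hε : 0 < ε) :
    IsExpSmall P fun n => {ω | n * (∫ x, h x ∂(P.map (W 0)) + ε)
      ≤ ∑ t ∈ Finset.range n, h (W t ω)} := by
  have hlogr : Real.log r < 0 := Real.log_neg hW.rate_pos hW.rate_lt_one
  -- the condition `lam < -log r` makes the mixing error decay despite the factor `exp lam`
  set lam : ℝ := min 1 (min (ε / 2) (-Real.log r / 2)) with hlam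
  have hl0 : 0 < lam := lt_min one_pos (lt_min (by linarith) (by linarith))
  have hl1 : lam ≤ 1 := min_le_left _ _
  have hl2 : lam ≤ ε / 2 := (min_le_right _ _).trans (min_le_left _ _)
  have hl3 : lam ≤ -Real.log r / 2 := (min_le_right _ _).trans (min_le_right _ _)
  set μ := ∫ x, h x ∂(P.map (W 0)) with hμ
  have hμ0 : 0 ≤ μ := integral_nonneg h0
  set ρ := Real.exp (-(lam * ε / 2)) with hρ
  have hρ0 : 0 < ρ := Real.exp_pos _
  have hρ1 : ρ < 1 := by rw [hρ, Real.exp_lt_one_iff]; simp only [neg_lt_zero]; positivity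
  set M := Real.exp lam with hM
  have hM1 : 1 ≤ M := Real.one_le_exp hl0.le
  have hMr : M * r < 1 := by
    rw [← Real.exp_log hW.rate_pos, hM, ← Real.exp_add, Real.exp_lt_one_iff]; linarith
  set θ := max ρ (M * r) with hθ
  have hθ0 : 0 < θ := hρ0.trans_le (le_max_left _ _)
  have hθ1 : θ < 1 := max_lt hρ1 hMr
  obtain ⟨K, k, hK, hk, hKk⟩ := exists_sq_mul_pow_le hθ0 hθ1
  set g : G → ℝ := fun x => Real.exp (lam * (h x - μ - ε)) with hg
  have hgm : Measurable g := by fun_prop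
  have hgM : ∀ x, g x ≤ M := fun x => by
    simp only [hg, hM]
    gcongr
    nlinarith [h1 x]
  have ha := hW.const_pos
  have hr := hW.rate_pos
  refine ⟨((θ ^ 2)⁻¹ + a) * K, k, by positivity, hk, fun n hn => ?_⟩
  set s := Nat.sqrt n with hs
  have hs1 : 1 ≤ s := Nat.sqrt_pos.2 hn
  have hsn : s * s ≤ n := Nat.sqrt_le n
  have hns : n < (s + 1) * (s + 1) := Nat.lt_succ_sqrt n
  set p := s + 1 with hp
  have hcls : ∀ i ∈ Finset.range p, P.real {ω | 0 ≤ ∑ t ∈ (Finset.range n).filter (fun t => t % p = i),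
      (h (W t ω) - μ - ε)} ≤ ((θ ^ 2)⁻¹ + a) * (p * θ ^ p) := by
    intro i hi
    rw [Finset.mem_range] at hi
    have hcard := n.count_modEq_card (r := p) (by omega) i
    rw [Nat.count_eq_card_filter_range] at hcard
    simp only [Nat.ModEq, Nat.mod_eq_of_lt hi] at hcard
    have hb := hW.integral_prod_residueClass_le hgm hM1 (fun x => (Real.exp_pos _).le) hgM hρ0.le
      hρ1.le (hW.integral_exponential_tilt_le hh h0 h1 hl0 hl1 hl2) p i n
    set T := (Finset.range n).filter (fun t => t % p = i)
    have hnp : n / p < p := Nat.div_lt_of_lt_mul hns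
    have hsp : s - 1 ≤ n / p := by
      rw [Nat.le_div_iff_mul_le (by omega)]
      obtain ⟨u, hu⟩ : ∃ u, s = u + 1 := ⟨s - 1, by omega⟩
      calc (s - 1) * p ≤ s * s := by rw [hp, hu, Nat.add_sub_cancel]; nlinarith
        _ ≤ n := hsn
    -- each residue class has between `s - 1` and `p` members
    have hc1 : s - 1 ≤ T.card := by omega
    have hc2 : T.card ≤ p := by split_ifs at hcard <;> omega
    have hexp : ∀ ω, ∏ t ∈ T, g (W t ω) = Real.exp (lam * ∑ t ∈ T, (h (W t ω) - μ - ε)) :=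
      fun ω => by rw [Finset.mul_sum, Real.exp_sum]
    have hprod : Measurable fun ω => ∏ t ∈ T, g (W t ω) :=
      Finset.measurable_fun_prod _ fun t _ => hgm.comp (hW.measurable t)
    have hint : Integrable (fun ω => ∏ t ∈ T, g (W t ω)) P := by
      refine .of_bound hprod.aestronglyMeasurable (M ^ T.card) (.of_forall fun ω => ?_)
      rw [Real.norm_eq_abs, abs_of_nonneg (Finset.prod_nonneg fun t _ => (Real.exp_pos _).le)]
      exact (Finset.prod_le_prod (fun t _ => (Real.exp_pos _).le) fun t _ => hgM _).trans_eq
        (Finset.prod_const M)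
    have hmarkov := mul_meas_ge_le_integral_of_nonneg
      (.of_forall fun ω => Finset.prod_nonneg fun t _ => (Real.exp_pos _).le) hint 1
    rw [one_mul] at hmarkov
    have hset : {ω | 0 ≤ ∑ t ∈ T, (h (W t ω) - μ - ε)} ⊆ {ω | 1 ≤ ∏ t ∈ T, g (W t ω)} :=
      fun ω hω => by
        simp only [Set.mem_ofPred_eq, hexp] at hω ⊢
        exact Real.one_le_exp (mul_nonneg hl0.le hω)
    have hp1 : (1 : ℝ) ≤ p := by exact_mod_cast (by omega : 1 ≤ p)
    calc P.real _ ≤ _ := measureReal_mono hset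
      _ ≤ _ := hmarkov.trans hb
      _ ≤ θ ^ (s - 1) + p * M ^ p * (a * r ^ p) := by
          gcongr
          exact (pow_le_pow_of_le_one hρ0.le hρ1.le hc1).trans
            (pow_le_pow_left₀ hρ0.le (le_max_left _ _) _)
      _ = (θ ^ 2)⁻¹ * θ ^ p + a * (p * (M * r) ^ p) := by
          rw [mul_pow, show p = (s - 1) + 2 by omega, pow_add θ]
          field_simp
      _ ≤ (θ ^ 2)⁻¹ * (p * θ ^ p) + a * (p * θ ^ p) := by
          gcongr
          · exact le_mul_of_one_le_left (by positivity) hp1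
          · exact le_max_right _ _
      _ = _ := by ring
  have hsub : {ω | n * (μ + ε) ≤ ∑ t ∈ Finset.range n, h (W t ω)} ⊆
      ⋃ i ∈ Finset.range p, {ω | 0 ≤ ∑ t ∈ (Finset.range n).filter (fun t => t % p = i),
        (h (W t ω) - μ - ε)} := by
    intro ω hω
    by_contra hcon
    simp only [Set.mem_iUnion, not_exists, Set.mem_ofPred_eq, not_le] at hcon hω
    have hlt := Finset.sum_lt_sum_of_nonempty (s := Finset.range p) ⟨0, by simp [hp]⟩ hcon
    rw [Finset.sum_fiberwise_of_maps_to
      (fun t _ => Finset.mem_range.2 (Nat.mod_lt t (by omega)))] at hlt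
    simp only [Finset.sum_sub_distrib, Finset.sum_const, Finset.card_range, nsmul_eq_mul,
      smul_zero] at hlt
    linarith
  calc P.real _ ≤ _ := measureReal_mono hsub (measure_ne_top _ _)
    _ ≤ ∑ i ∈ Finset.range p, ((θ ^ 2)⁻¹ + a) * (p * θ ^ p) :=
        (measureReal_biUnion_finset_le _ _).trans (Finset.sum_le_sum hcls)
    _ = ((θ ^ 2)⁻¹ + a) * ((p : ℝ) ^ 2 * θ ^ p) := by
        rw [Finset.sum_const, Finset.card_range, nsmul_eq_mul]; ring
    _ ≤ ((θ ^ 2)⁻¹ + a) * (K * Real.exp (-k * p)) := 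
        mul_le_mul_of_nonneg_left (hKk p) (by positivity)
    _ ≤ ((θ ^ 2)⁻¹ + a) * K * Real.exp (-k * √n) := by
        rw [← mul_assoc, neg_mul, neg_mul]
        gcongr
        refine Real.sqrt_le_iff.2 ⟨by positivity, ?_⟩
        exact_mod_cast (by nlinarith : n ≤ p ^ 2)

end IsGeometricallyMixing

end GeometricMixing

/-! ### Exponential concentration of vector-valued averages -/

section LawOfLargeNumbers

variable {Ω G : Type*} [mΩ : MeasurableSpace Ω] [MeasurableSpace G]
  {P : Measure Ω} {W : ℕ → Ω → G} {a r : ℝ} [IsProbabilityMeasure P]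

namespace IsGeometricallyMixing

lemma isProbabilityMeasure_map (hW : IsGeometricallyMixing P W a r) :
    IsProbabilityMeasure (P.map (W 0)) :=
  Measure.isProbabilityMeasure_map (hW.measurable 0).aemeasurable

lemma isExpSmall_abs_sum_indicator (hW : IsGeometricallyMixing P W a r) {A : Set G}
    (hA : MeasurableSet A) {ε : ℝ} (hε : 0 < ε) :
    IsExpSmall P fun n => {ω | n * ε < |∑ t ∈ Finset.range n,
      (A.indicator (fun _ => (1 : ℝ)) (W t ω) - (P.map (W 0)).real A)|} := by
  have := hW.isProbabilityMeasure_map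
  have key : ∀ B : Set G, MeasurableSet B → IsExpSmall P fun n => {ω | n * ε
      ≤ ∑ t ∈ Finset.range n, (B.indicator (fun _ => (1 : ℝ)) (W t ω) - (P.map (W 0)).real B)} := by
    intro B hB
    refine (hW.isExpSmall_sum_ge (h := B.indicator fun _ => 1) (measurable_const.indicator hB)
      (fun x => Set.indicator_nonneg (fun _ _ => zero_le_one) x)
      (fun x => Set.indicator_le_self' (fun _ _ => zero_le_one) x) hε).mono fun n _ ω hω => ?_
    simp only [Set.mem_ofPred_eq, Finset.sum_sub_distrib, Finset.sum_const, Finset.card_range,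
      nsmul_eq_mul] at hω ⊢
    rw [integral_indicator_const _ hB]
    simp only [smul_eq_mul, mul_one]
    linarith
  refine ((key A hA).union (key Aᶜ hA.compl)).mono fun n _ ω hω => ?_
  simp only [Set.mem_ofPred_eq, Set.mem_union] at hω ⊢
  have e : ∑ t ∈ Finset.range n,
        (Aᶜ.indicator (fun _ => (1 : ℝ)) (W t ω) - (P.map (W 0)).real Aᶜ)
      = -∑ t ∈ Finset.range n,
        (A.indicator (fun _ => (1 : ℝ)) (W t ω) - (P.map (W 0)).real A) := by
    rw [← Finset.sum_neg_distrib]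
    refine Finset.sum_congr rfl fun t _ => ?_
    rw [probReal_compl_eq_one_sub hA]
    by_cases h : W t ω ∈ A <;> simp [h]
  rw [e]
  rcases lt_abs.1 hω with h | h
  · exact .inl h.le
  · exact .inr h.le

variable {V : Type*} [NormedAddCommGroup V] [NormedSpace ℝ V] [CompleteSpace V]

lemma isExpSmall_norm_sum_simpleFunc (hW : IsGeometricallyMixing P W a r) (g : SimpleFunc G V) :
    ∀ ε : ℝ, 0 < ε → IsExpSmall P fun n => {ω | n * ε <
      ‖∑ t ∈ Finset.range n, (g (W t ω) - ∫ x, g x ∂(P.map (W 0)))‖} := by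
  have := hW.isProbabilityMeasure_map
  induction g using SimpleFunc.induction with
  | const c hA =>
    rename_i A
    intro ε hε
    refine (hW.isExpSmall_abs_sum_indicator hA (ε := ε / (‖c‖ + 1)) (by positivity)).mono
      fun n _ ω hω => ?_
    simp only [Set.mem_ofPred_eq] at hω ⊢
    have e : ∑ t ∈ Finset.range n, ((SimpleFunc.piecewise A hA (SimpleFunc.const G c)
        (SimpleFunc.const G 0)) (W t ω) - ∫ x, (SimpleFunc.piecewise A hA (SimpleFunc.const G c)
        (SimpleFunc.const G 0)) x ∂(P.map (W 0)))
        = (∑ t ∈ Finset.range n,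
          (A.indicator (fun _ => (1 : ℝ)) (W t ω) - (P.map (W 0)).real A)) • c := by
      rw [Finset.sum_smul]
      refine Finset.sum_congr rfl fun t _ => ?_
      rw [sub_smul]
      congr 1
      · by_cases h : W t ω ∈ A <;> simp [h]
      · simp only [SimpleFunc.coe_piecewise, SimpleFunc.coe_const, Function.const_zero,
          Set.piecewise_eq_indicator]
        exact integral_indicator_const c hA
    rw [e, norm_smul, Real.norm_eq_abs] at hω
    set S := |∑ t ∈ Finset.range n, (A.indicator (fun _ => (1 : ℝ)) (W t ω) - (P.map (W 0)).real A)|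
    have hS : 0 ≤ S := abs_nonneg _
    rw [← mul_div_assoc, div_lt_iff₀ (by positivity)]
    nlinarith
  | add hfg ihf ihg =>
    rename_i f g
    intro ε hε
    refine ((ihf (ε / 2) (by positivity)).union (ihg (ε / 2) (by positivity))).mono
      fun n _ ω hω => ?_
    simp only [Set.mem_ofPred_eq, Set.mem_union] at hω ⊢
    by_contra! hcon
    have e : ∑ t ∈ Finset.range n, ((f + g) (W t ω) - ∫ x, (f + g) x ∂(P.map (W 0)))
        = ∑ t ∈ Finset.range n, (f (W t ω) - ∫ x, f x ∂(P.map (W 0)))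
          + ∑ t ∈ Finset.range n, (g (W t ω) - ∫ x, g x ∂(P.map (W 0))) := by
      rw [← Finset.sum_add_distrib]
      refine Finset.sum_congr rfl fun t _ => ?_
      simp only [SimpleFunc.coe_add, Pi.add_apply]
      rw [integral_add f.integrable_of_isFiniteMeasure g.integrable_of_isFiniteMeasure]
      abel
    rw [e] at hω
    linarith [norm_add_le (∑ t ∈ Finset.range n, (f (W t ω) - ∫ x, f x ∂(P.map (W 0))))
      (∑ t ∈ Finset.range n, (g (W t ω) - ∫ x, g x ∂(P.map (W 0)))), hcon.1, hcon.2]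

/-- Exponential concentration for bounded observables with values in a Banach space. A simple
function close in `L¹` reduces it to finitely many indicators, and the approximation error is itself
controlled by the real-valued large deviation bound. -/
lemma isExpSmall_norm_sum (hW : IsGeometricallyMixing P W a r) {f : G → V}
    (hf : StronglyMeasurable f) {K : ℝ} (hfK : ∀ x, ‖f x‖ ≤ K) {ε : ℝ} (hε : 0 < ε) :
    IsExpSmall P fun n => {ω | n * ε <
      ‖∑ t ∈ Finset.range n, (f (W t ω) - ∫ x, f x ∂(P.map (W 0)))‖} := by
  have := hW.isProbabilityMeasure_map
  set ν := P.map (W 0)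
  have hK0 : 0 ≤ K := by
    obtain ⟨x⟩ := ν.nonempty_of_neZero
    exact (norm_nonneg _).trans (hfK x)
  have hfi : Integrable f ν := .of_bound hf.aestronglyMeasurable K (.of_forall hfK)
  have hlim : Tendsto (fun m => ∫ x, ‖f x - hf.approxBounded K m x‖ ∂ν) atTop (𝓝 0) := by
    rw [show (0 : ℝ) = ∫ _, (0 : ℝ) ∂ν by simp]
    refine tendsto_integral_of_dominated_convergence (fun _ => K + K)
      (fun m => (hf.sub (SimpleFunc.stronglyMeasurable _)).norm.aestronglyMeasurable)
      (integrable_const _) (fun m => .of_forall fun x => ?_) (.of_forall fun x => ?_)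
    · rw [norm_norm]
      exact (norm_sub_le _ _).trans (add_le_add (hfK x) (hf.norm_approxBounded_le hK0 m x))
    · have h := (hf.tendsto_approxBounded_of_norm_le (hfK x)).const_sub (f x)
      simpa using h.norm
  obtain ⟨m, hm⟩ := (hlim.eventually_lt_const (show (0 : ℝ) < ε / 8 by positivity)).exists
  set g := hf.approxBounded K m
  -- dividing by `L` brings the approximation error into `[0, 1]`
  set L := 2 * K + 1 with hL
  have hL0 : 0 < L := by positivity
  have hfg : StronglyMeasurable fun x => ‖f x - g x‖ := (hf.sub g.stronglyMeasurable).norm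
  have h1 := hW.isExpSmall_norm_sum_simpleFunc g (ε / 4) (by positivity)
  have h2 := hW.isExpSmall_sum_ge (h := fun x => ‖f x - g x‖ / L)
    (hfg.measurable.div_const _) (fun x => by positivity)
    (fun x => (div_le_one hL0).2 <| (norm_sub_le _ _).trans (by
      linarith [hfK x, hf.norm_approxBounded_le hK0 m x]))
    (ε := ε / (4 * L)) (by positivity)
  refine (h1.union h2).mono fun n hn ω hω => ?_
  simp only [Set.mem_ofPred_eq, Set.mem_union] at hω ⊢
  by_contra! hcon
  obtain ⟨hc1, hc2⟩ := hcon
  rw [integral_div, ← Finset.sum_div, div_lt_iff₀ hL0] at hc2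
  have e2 : n * ((∫ x, ‖f x - g x‖ ∂ν) / L + ε / (4 * L)) * L
      = n * (∫ x, ‖f x - g x‖ ∂ν + ε / 4) := by field_simp
  rw [e2] at hc2
  have e : ∑ t ∈ Finset.range n, (f (W t ω) - ∫ x, f x ∂ν)
      = ∑ t ∈ Finset.range n, (g (W t ω) - ∫ x, g x ∂ν)
        + ∑ t ∈ Finset.range n, (f (W t ω) - g (W t ω))
        - n • ∫ x, (f x - g x) ∂ν := by
    rw [integral_sub hfi g.integrable_of_isFiniteMeasure]
    simp only [Finset.sum_sub_distrib, Finset.sum_const, Finset.card_range, smul_sub]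
    abel
  have h3 : ‖n • ∫ x, (f x - g x) ∂ν‖ ≤ n * ∫ x, ‖f x - g x‖ ∂ν := by
    refine norm_nsmul_le.trans ?_
    gcongr
    exact norm_integral_le_integral_norm _
  have h4 : ‖∑ t ∈ Finset.range n, (f (W t ω) - g (W t ω))‖
      ≤ ∑ t ∈ Finset.range n, ‖f (W t ω) - g (W t ω)‖ := norm_sum_le _ _
  have hn0 : (0 : ℝ) < n := by exact_mod_cast hn
  rw [e] at hω
  have h5 := norm_sub_le (∑ t ∈ Finset.range n, (g (W t ω) - ∫ x, g x ∂ν)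
        + ∑ t ∈ Finset.range n, (f (W t ω) - g (W t ω))) (n • ∫ x, (f x - g x) ∂ν)
  have h6 := norm_add_le (∑ t ∈ Finset.range n, (g (W t ω) - ∫ x, g x ∂ν))
    (∑ t ∈ Finset.range n, (f (W t ω) - g (W t ω)))
  nlinarith

end IsGeometricallyMixing

end LawOfLargeNumbers

/-! ### Second moments and a maximal inequality -/

section MaximalInequality

lemma sum_pow_le_of_injOn {T : Finset ℕ} {φ : ℕ → ℕ} (hφ : Set.InjOn φ T) {q : ℝ} (h0 : 0 ≤ q)
    (h1 : q < 1) : ∑ t ∈ T, q ^ φ t ≤ (1 - q)⁻¹ := by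
  rw [← Finset.sum_image (f := fun k => q ^ k) hφ, ← tsum_geometric_of_lt_one h0 h1]
  exact (summable_geometric_of_lt_one h0 h1).sum_le_tsum _ fun _ _ => pow_nonneg h0 _

/-- Summability of the covariances, uniformly in the position `s`. -/
lemma sum_pow_dist_le (T : Finset ℕ) (s : ℕ) {q : ℝ} (h0 : 0 ≤ q) (h1 : q < 1) :
    ∑ t ∈ T, q ^ Nat.dist s t ≤ 2 * (1 - q)⁻¹ := by
  rw [← Finset.sum_filter_add_sum_filter_not T (fun t => t ≤ s), two_mul]
  refine add_le_add (sum_pow_le_of_injOn ?_ h0 h1) (sum_pow_le_of_injOn ?_ h0 h1) <;>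
  · intro x hx y hy hxy
    simp only [Finset.coe_filter, Set.mem_ofPred_eq] at hx hy
    simp only [Nat.dist] at hxy
    omega

variable {Ω G : Type*} [mΩ : MeasurableSpace Ω] [MeasurableSpace G]
  {P : Measure Ω} {W : ℕ → Ω → G} {a r : ℝ}
  {F : Type*} [NormedAddCommGroup F] [InnerProductSpace ℝ F] [CompleteSpace F]

namespace IsGeometricallyMixing

/-- The constant in the second moment bound for sums of centered observables bounded by `K`. -/
noncomputable def momentConst (a r K : ℝ) : ℝ := 13 * K ^ 2 * √a * (2 * (1 - √r)⁻¹)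

lemma momentConst_nonneg (hW : IsGeometricallyMixing P W a r) (K : ℝ) :
    0 ≤ momentConst a r K := by
  have : √r < 1 := by
    rw [Real.sqrt_lt' one_pos, one_pow]
    exact hW.rate_lt_one
  have : 0 ≤ (1 - √r)⁻¹ := inv_nonneg.2 (by linarith)
  unfold momentConst
  positivity

omit mΩ [InnerProductSpace ℝ F] [CompleteSpace F] in
lemma stronglyMeasurable_comp {f : G → F} (hf : StronglyMeasurable f) {I : Set ℕ} {t : ℕ}
    (ht : t ∈ I) : StronglyMeasurable[generatedField W I] fun ω => f (W t ω) :=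
  hf.comp_measurable (measurable_generatedField ht)

variable [IsProbabilityMeasure P]

lemma integral_inner_le (hW : IsGeometricallyMixing P W a r) {f : G → F}
    (hf : StronglyMeasurable f) {K : ℝ} (hK : 0 < K) (hfK : ∀ x, ‖f x‖ ≤ K)
    (hf0 : ∫ x, f x ∂(P.map (W 0)) = 0) (s t : ℕ) :
    ∫ ω, ⟪f (W s ω), f (W t ω)⟫_ℝ ∂P ≤ 13 * K ^ 2 * √a * √r ^ Nat.dist s t := by
  have key : ∀ s d, ∫ ω, ⟪f (W s ω), f (W (s + d) ω)⟫_ℝ ∂P ≤ 13 * K ^ 2 * √a * √r ^ d := by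
    intro s d
    have hpos : 0 < a * r ^ d := mul_pos hW.const_pos (pow_pos hW.rate_pos _)
    have h := abs_integral_inner_le (P := P) (generatedField_le hW.measurable (Set.Iic s))
      (generatedField_le hW.measurable (Set.Ici (s + d))) hpos (hW.mixing s d) hK
      (stronglyMeasurable_comp (t := s) hf (by simp)) (fun ω => hfK _)
      (stronglyMeasurable_comp (t := s + d) hf (by simp)) (fun ω => hfK _)
      ((hW.integral_comp hf s).trans hf0) ((hW.integral_comp hf _).trans hf0)
    have hsqrt : √(r ^ d) = √r ^ d := by
      rw [← Real.sqrt_sq (pow_nonneg (Real.sqrt_nonneg r) d), ← pow_mul, mul_comm, pow_mul,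
        Real.sq_sqrt hW.rate_pos.le]
    rw [Real.sqrt_mul hW.const_pos.le, hsqrt, ← mul_assoc] at h
    exact (le_abs_self _).trans h
  rcases le_total s t with h | h
  · have := key s (t - s)
    rwa [Nat.add_sub_cancel' h, ← Nat.dist_eq_sub_of_le h] at this
  · have := key t (s - t)
    simp_rw [real_inner_comm (f (W t _))]
    rwa [Nat.add_sub_cancel' h, ← Nat.dist_eq_sub_of_le_right h] at this

/-- The second moment of a sum grows at most linearly in the number of summands. -/
lemma integral_norm_sq_sum_le (hW : IsGeometricallyMixing P W a r) {f : G → F}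
    (hf : StronglyMeasurable f) {K : ℝ} (hK : 0 < K) (hfK : ∀ x, ‖f x‖ ≤ K)
    (hf0 : ∫ x, f x ∂(P.map (W 0)) = 0) (T : Finset ℕ) :
    ∫ ω, ‖∑ t ∈ T, f (W t ω)‖ ^ 2 ∂P ≤ momentConst a r K * T.card := by
  have hsm : ∀ t, StronglyMeasurable fun ω => f (W t ω) := fun t =>
    hf.comp_measurable (hW.measurable t)
  have hint : ∀ s t, Integrable (fun ω => ⟪f (W s ω), f (W t ω)⟫_ℝ) P := fun s t => by
    refine .of_bound ((hsm s).inner (hsm t)).aestronglyMeasurable (K * K) (.of_forall fun ω => ?_)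
    exact (norm_inner_le_norm _ _).trans (mul_le_mul (hfK _) (hfK _) (norm_nonneg _) hK.le)
  have hq : √r < 1 := by
    rw [Real.sqrt_lt' one_pos, one_pow]
    exact hW.rate_lt_one
  have e : ∀ ω, ‖∑ t ∈ T, f (W t ω)‖ ^ 2 = ∑ s ∈ T, ∑ t ∈ T, ⟪f (W s ω), f (W t ω)⟫_ℝ := fun ω => by
    rw [← real_inner_self_eq_norm_sq, sum_inner]
    simp_rw [inner_sum]
  simp_rw [e]
  rw [integral_finsetSum _ fun s _ => integrable_finsetSum _ fun t _ => hint s t]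
  calc _ = ∑ s ∈ T, ∑ t ∈ T, ∫ ω, ⟪f (W s ω), f (W t ω)⟫_ℝ ∂P :=
        Finset.sum_congr rfl fun s _ => integral_finsetSum _ fun t _ => hint s t
    _ ≤ ∑ s ∈ T, ∑ t ∈ T, 13 * K ^ 2 * √a * √r ^ Nat.dist s t := by
        gcongr with s _ t _
        exact hW.integral_inner_le hf hK hfK hf0 s t
    _ ≤ ∑ s ∈ T, momentConst a r K := by
        refine Finset.sum_le_sum fun s _ => ?_
        rw [← Finset.mul_sum, momentConst]
        gcongr
        exact sum_pow_dist_le T s (Real.sqrt_nonneg _) hq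
    _ = _ := by rw [Finset.sum_const, nsmul_eq_mul, mul_comm]

lemma measureReal_lt_norm_sum_le (hW : IsGeometricallyMixing P W a r) {f : G → F}
    (hf : StronglyMeasurable f) {K : ℝ} (hK : 0 < K) (hfK : ∀ x, ‖f x‖ ≤ K)
    (hf0 : ∫ x, f x ∂(P.map (W 0)) = 0) (T : Finset ℕ) {x : ℝ} (hx : 0 < x) :
    P.real {ω | x < ‖∑ t ∈ T, f (W t ω)‖} ≤ momentConst a r K * T.card / x ^ 2 := by
  rw [le_div_iff₀' (by positivity)]
  have hsm : StronglyMeasurable fun ω => ‖∑ t ∈ T, f (W t ω)‖ ^ 2 :=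
    (Finset.stronglyMeasurable_fun_sum T fun t _ =>
      hf.comp_measurable (hW.measurable t)).norm.pow 2
  have hint : Integrable (fun ω => ‖∑ t ∈ T, f (W t ω)‖ ^ 2) P := by
    refine .of_bound hsm.aestronglyMeasurable ((T.card * K) ^ 2) (.of_forall fun ω => ?_)
    rw [norm_pow, norm_norm]
    gcongr
    exact (norm_sum_le_of_le T fun t _ => hfK (W t ω)).trans_eq (by simp)
  refine le_trans ?_ ((mul_meas_ge_le_integral_of_nonneg (.of_forall fun ω => by positivity)
    hint (x ^ 2)).trans (hW.integral_norm_sq_sum_le hf hK hfK hf0 T))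
  gcongr
  · exact measure_ne_top _ _
  · intro h
    exact pow_le_pow_left₀ hx.le (le_of_lt h) 2

/-- An Ottaviani-type maximal inequality. After the first time `k` at which the partial sums exceed
`3 * x`, the increment from time `k + p` on is nearly independent of the past, and the `p` summands
left out contribute at most `x`. -/
lemma measureReal_exists_lt_norm_sum_le (hW : IsGeometricallyMixing P W a r) {f : G → F}
    (hf : StronglyMeasurable f) {K : ℝ} (hK : 0 < K) (hfK : ∀ x, ‖f x‖ ≤ K)
    (hf0 : ∫ x, f x ∂(P.map (W 0)) = 0) (n p : ℕ) {x : ℝ} (hx : 0 < x) (hpx : p * K ≤ x)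
    (hnx : momentConst a r K * n ≤ x ^ 2 / 2) :
    P.real {ω | ∃ k ≤ n, 3 * x < ‖∑ t ∈ Finset.range k, f (W t ω)‖}
      ≤ 2 * (momentConst a r K * n / x ^ 2) + 2 * ((n + 1) * (a * r ^ p)) := by
  set S : ℕ → Ω → F := fun k ω => ∑ t ∈ Finset.range k, f (W t ω) with hS
  -- `A k`: the partial sums exceed `3 * x` for the first time at `k`
  set A : ℕ → Set Ω := fun k =>
    (⋂ j ∈ Finset.range k, (fun ω => ‖S j ω‖) ⁻¹' Set.Iic (3 * x))
      ∩ (fun ω => ‖S k ω‖) ⁻¹' Set.Ioi (3 * x) with hA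
  -- `B k`: the increment from time `k + p` to time `n` exceeds `x`
  set B : ℕ → Set Ω := fun k =>
    (fun ω => ‖∑ t ∈ Finset.Ico (k + p) n, f (W t ω)‖) ⁻¹' Set.Ioi x with hB
  have hmem : ∀ k ω, ω ∈ A k ↔ (∀ j < k, ‖S j ω‖ ≤ 3 * x) ∧ 3 * x < ‖S k ω‖ := fun k ω => by
    simp [hA]
  have hAm : ∀ k, MeasurableSet[generatedField W (Set.Iic k)] (A k) := fun k => by
    have hSm : ∀ j ≤ k, StronglyMeasurable[generatedField W (Set.Iic k)] (S j) := fun j hj =>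
      Finset.stronglyMeasurable_fun_sum _ fun t ht =>
        stronglyMeasurable_comp hf (by simp at ht ⊢; omega)
    refine MeasurableSet.inter (Finset.measurableSet_biInter _ fun j hj => ?_) ?_
    · exact (hSm j (Finset.mem_range.1 hj).le).norm.measurable measurableSet_Iic
    · exact (hSm k le_rfl).norm.measurable measurableSet_Ioi
  have hBm : ∀ k, MeasurableSet[generatedField W (Set.Ici (k + p))] (B k) := fun k => by
    have hSm : StronglyMeasurable[generatedField W (Set.Ici (k + p))]
        (fun ω => ∑ t ∈ Finset.Ico (k + p) n, f (W t ω)) :=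
      Finset.stronglyMeasurable_fun_sum _ fun t ht =>
        stronglyMeasurable_comp hf (by simp at ht ⊢; omega)
    exact hSm.norm.measurable measurableSet_Ioi
  set C := momentConst a r K with hC
  have hC0 : 0 ≤ C := hW.momentConst_nonneg K
  have hBhalf : ∀ k, P.real (B k) ≤ 1 / 2 := fun k => by
    refine (hW.measureReal_lt_norm_sum_le hf hK hfK hf0 (Finset.Ico (k + p) n) hx).trans ?_
    rw [div_le_iff₀ (by positivity)]
    calc C * (Finset.Ico (k + p) n).card ≤ C * n := by
          gcongr
          simp
      _ ≤ 1 / 2 * x ^ 2 := by linarith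
  have hsn : P.real {ω | x < ‖S n ω‖} ≤ C * n / x ^ 2 := by
    have := hW.measureReal_lt_norm_sum_le hf hK hfK hf0 (Finset.range n) hx
    rwa [Finset.card_range] at this
  have hdisj : (Finset.range (n + 1) : Set ℕ).PairwiseDisjoint A := by
    have key : ∀ i j, i < j → Disjoint (A i) (A j) := fun i j hij =>
      Set.disjoint_left.2 fun ω hi hj =>
        absurd (((hmem j ω).1 hj).1 i hij) (not_le.2 ((hmem i ω).1 hi).2)
    intro i _ j _ hij
    rcases lt_or_gt_of_ne hij with h | h
    · exact key i j h
    · exact (key j i h).symm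
  have hunion : {ω | ∃ k ≤ n, 3 * x < ‖S k ω‖} = ⋃ k ∈ Finset.range (n + 1), A k := by
    ext ω
    simp only [Set.mem_ofPred_eq, Set.mem_iUnion, Finset.mem_range, hmem, exists_prop]
    constructor
    · intro h
      classical
      refine ⟨Nat.find h, ?_, fun j hj => ?_, (Nat.find_spec h).2⟩
      · have := (Nat.find_spec h).1; omega
      · have h1 := Nat.find_min h hj
        have h2 := (Nat.find_spec h).1
        by_contra! h3
        exact h1 ⟨by omega, h3⟩
    · rintro ⟨k, hk, -, h⟩
      exact ⟨k, by omega, h⟩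
  have hsub : (⋃ k ∈ Finset.range (n + 1), A k)
      ⊆ {ω | x < ‖S n ω‖} ∪ ⋃ k ∈ Finset.range (n + 1), (A k ∩ B k) := by
    intro ω hω
    by_contra hcon
    simp only [Set.mem_union, Set.mem_iUnion, Set.mem_ofPred_eq, not_or, not_exists, not_lt,
      Finset.mem_range, exists_prop] at hω hcon
    obtain ⟨k, hk, hkA⟩ := hω
    obtain ⟨hc1, hc2⟩ := hcon
    have hkB : ‖∑ t ∈ Finset.Ico (k + p) n, f (W t ω)‖ ≤ x := by
      by_contra! h
      exact hc2 k ⟨hk, hkA, h⟩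
    have hk3 := ((hmem k ω).1 hkA).2
    have hinc : S k ω + ∑ t ∈ Finset.Ico k n, f (W t ω) = S n ω :=
      Finset.sum_range_add_sum_Ico _ (by omega)
    have hshort : ∀ l ≤ k + p, ‖∑ t ∈ Finset.Ico k l, f (W t ω)‖ ≤ x := fun l hl => by
      refine (norm_sum_le_of_le _ fun t _ => hfK (W t ω)).trans (le_trans ?_ hpx)
      rw [Finset.sum_const, Nat.card_Ico, nsmul_eq_mul]
      gcongr
      omega
    have htail : ‖∑ t ∈ Finset.Ico k n, f (W t ω)‖ ≤ 2 * x := by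
      rcases le_total n (k + p) with h | h
      · linarith [hshort n h]
      · rw [← Finset.sum_Ico_consecutive _ (Nat.le_add_right k p) h]
        linarith [norm_add_le (∑ t ∈ Finset.Ico k (k + p), f (W t ω))
          (∑ t ∈ Finset.Ico (k + p) n, f (W t ω)), hshort (k + p) le_rfl]
    have : ‖S k ω‖ ≤ ‖S n ω‖ + ‖∑ t ∈ Finset.Ico k n, f (W t ω)‖ := by
      rw [← hinc]
      exact norm_le_add_norm_add _ _
    linarith
  have hmeas : P.real (⋃ k ∈ Finset.range (n + 1), A k) = ∑ k ∈ Finset.range (n + 1), P.real (A k) :=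
    measureReal_biUnion_finset hdisj fun k _ => generatedField_le hW.measurable _ _ (hAm k)
  have hAB : ∀ k, P.real (A k ∩ B k) ≤ P.real (A k) * (1 / 2) + a * r ^ p := fun k => by
    have h1 := (abs_le.1 (hW.mixing k p _ _ (hAm k) (hBm k))).2
    have h2 := mul_le_mul_of_nonneg_left (hBhalf k) (measureReal_nonneg (μ := P) (s := A k))
    linarith
  have hmain : P.real (⋃ k ∈ Finset.range (n + 1), A k)
      ≤ C * n / x ^ 2 + (P.real (⋃ k ∈ Finset.range (n + 1), A k) * (1 / 2)
        + (n + 1) * (a * r ^ p)) := by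
    refine (measureReal_mono hsub (measure_ne_top _ _)).trans ((measureReal_union_le _ _).trans ?_)
    gcongr
    refine (measureReal_biUnion_finset_le _ _).trans
      ((Finset.sum_le_sum fun k _ => hAB k).trans_eq ?_)
    rw [Finset.sum_add_distrib, ← Finset.sum_mul, ← hmeas, Finset.sum_const, Finset.card_range,
      nsmul_eq_mul]
    push_cast
    ring
  rw [hunion]
  linarith

end IsGeometricallyMixing

end MaximalInequality

/-! ### The almost sure rate -/

section AlmostSureRate

lemma natLog_two_add_one_le {n : ℕ} (hn : 2 ≤ n) : (Nat.log 2 n : ℝ) + 1 ≤ 4 * Real.log n := by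
  have hlog2 := Real.log_two_gt_d9
  have h1 : (2 : ℝ) ^ Nat.log 2 n ≤ n := by exact_mod_cast Nat.pow_log_le_self 2 (by omega)
  have h2 : Nat.log 2 n * Real.log 2 ≤ Real.log n := by
    rw [← Real.log_pow]
    exact Real.log_le_log (by positivity) h1
  have h3 : Real.log 2 ≤ Real.log n := Real.log_le_log two_pos (by exact_mod_cast hn)
  nlinarith [(Nat.cast_nonneg (Nat.log 2 n) : (0 : ℝ) ≤ _)]

variable {Ω G : Type*} [mΩ : MeasurableSpace Ω] [MeasurableSpace G]
  {P : Measure Ω} {W : ℕ → Ω → G} {a r : ℝ} [IsProbabilityMeasure P]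
  {F : Type*} [NormedAddCommGroup F] [InnerProductSpace ℝ F] [CompleteSpace F]

namespace IsGeometricallyMixing

/-- Up to time `2 ^ m` the partial sums exceed `3 * √(2 ^ m) * m` only with summable probability:
the maximal inequality is applied with a gap proportional to `m`. -/
lemma exists_summable_bound_dyadic (hW : IsGeometricallyMixing P W a r) {f : G → F}
    (hf : StronglyMeasurable f) {K : ℝ} (hK : 0 < K) (hfK : ∀ x, ‖f x‖ ≤ K)
    (hf0 : ∫ x, f x ∂(P.map (W 0)) = 0) :
    ∃ b : ℕ → ℝ, Summable b ∧ ∀ᶠ m : ℕ in atTop,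
      P.real {ω | ∃ k ≤ 2 ^ m, 3 * (√(2 ^ m) * m) < ‖∑ t ∈ Finset.range k, f (W t ω)‖} ≤ b m := by
  have ha := hW.const_pos
  have hr := hW.rate_pos
  -- a gap of length `N * m` makes `2 ^ m * r ^ (N * m)` summable
  obtain ⟨N, hN⟩ := exists_pow_lt_of_lt_one (show (0 : ℝ) < 1 / 4 by norm_num) hW.rate_lt_one
  -- the two summands correspond to the second moment bound and to the mixing error
  refine ⟨fun m => 2 * momentConst a r K * ((m : ℝ) ^ 2)⁻¹ + 4 * a * (1 / 2) ^ m, ?_, ?_⟩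
  · exact ((Real.summable_nat_pow_inv.2 one_lt_two).mul_left _).add
      ((summable_geometric_of_lt_one (by norm_num) (by norm_num)).mul_left _)
  · have hsqrt : Tendsto (fun m : ℕ => √((2 : ℝ) ^ m)) atTop atTop :=
      Real.tendsto_sqrt_atTop.comp (tendsto_pow_atTop_atTop_of_one_lt one_lt_two)
    have hm2 : Tendsto (fun m : ℕ => (m : ℝ) ^ 2) atTop atTop :=
      (tendsto_pow_atTop two_ne_zero).comp tendsto_natCast_atTop_atTop
    filter_upwards [hsqrt.eventually_ge_atTop (N * K), hm2.eventually_ge_atTop (2 * momentConst a r K),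
      eventually_ge_atTop 1] with m h1 h2 hm
    have hm0 : (0 : ℝ) < m := by exact_mod_cast hm
    have hx2 : (√(2 ^ m) * (m : ℝ)) ^ 2 = 2 ^ m * (m : ℝ) ^ 2 := by
      rw [mul_pow, Real.sq_sqrt (by positivity)]
    have h2m : (0 : ℝ) < 2 ^ m := by positivity
    refine (hW.measureReal_exists_lt_norm_sum_le hf hK hfK hf0 (2 ^ m) (N * m)
      (x := √(2 ^ m) * m) (by positivity) ?_ ?_).trans ?_
    · push_cast
      nlinarith
    · push_cast
      rw [hx2]
      nlinarith
    · rw [hx2]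
      push_cast
      gcongr ?_ + ?_
      · refine le_of_eq ?_
        field_simp
      · have h3 : r ^ (N * m) ≤ (1 / 4) ^ m := by
          rw [pow_mul]
          gcongr
        have h4 : ((1 : ℝ) / 4) ^ m = (1 / 2) ^ m * (1 / 2) ^ m := by
          rw [← mul_pow]; norm_num
        have h5 : (2 : ℝ) ^ m * (1 / 2) ^ m = 1 := by rw [← mul_pow]; norm_num
        have h6 : (1 : ℝ) ≤ 2 ^ m := one_le_pow₀ one_le_two
        calc 2 * (((2 : ℝ) ^ m + 1) * (a * r ^ (N * m)))
            ≤ 2 * (((2 : ℝ) ^ m + 2 ^ m) * (a * ((1 / 2) ^ m * (1 / 2) ^ m))) := by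
              rw [← h4]; gcongr
          _ = 4 * a * (1 / 2) ^ m * ((2 : ℝ) ^ m * (1 / 2) ^ m) := by ring
          _ = _ := by rw [h5, mul_one]

lemma ae_isBigO_norm_sum_of_centered (hW : IsGeometricallyMixing P W a r) {f : G → F}
    (hf : StronglyMeasurable f) {K : ℝ} (hK : 0 < K) (hfK : ∀ x, ‖f x‖ ≤ K)
    (hf0 : ∫ x, f x ∂(P.map (W 0)) = 0) :
    ∀ᵐ ω ∂P, (fun n : ℕ => ‖∑ t ∈ Finset.range n, f (W t ω)‖) =O[atTop]
      fun n : ℕ => √n * Real.log n := by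
  obtain ⟨b, hb, hev⟩ := hW.exists_summable_bound_dyadic hf hK hfK hf0
  obtain ⟨m₀, hm₀⟩ := eventually_atTop.1 hev
  set D : ℕ → Set Ω := fun m =>
    {ω | ∃ k ≤ 2 ^ m, 3 * (√(2 ^ m) * m) < ‖∑ t ∈ Finset.range k, f (W t ω)‖} with hD
  have hsum : ∑' i, P (D (i + m₀)) ≠ ⊤ := by
    have hle : ∀ i, P (D (i + m₀)) ≤ ENNReal.ofReal (b (i + m₀)) := fun i => by
      rw [← ofReal_measureReal (measure_ne_top _ _)]
      exact ENNReal.ofReal_le_ofReal (hm₀ _ (by omega))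
    exact ne_top_of_le_ne_top ((summable_nat_add_iff m₀).2 hb).tsum_ofReal_ne_top
      (ENNReal.tsum_le_tsum hle)
  filter_upwards [ae_eventually_notMem hsum] with ω hω
  obtain ⟨i₀, hi₀⟩ := eventually_atTop.1 hω
  refine IsBigO.of_bound (3 * √2 * 4) ?_
  filter_upwards [eventually_ge_atTop (2 ^ (i₀ + m₀)), eventually_ge_atTop 2] with n hn hn2
  have hlog : i₀ + m₀ ≤ Nat.log 2 n := (Nat.le_log_iff_pow_le one_lt_two (by omega)).2 hn
  set m := Nat.log 2 n + 1 with hm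
  have hnm : n ≤ 2 ^ m := (Nat.lt_pow_succ_log_self one_lt_two n).le
  have hmn : (2 : ℝ) ^ m ≤ 2 * n := by
    rw [hm, pow_succ, mul_comm]
    have : (2 : ℝ) ^ Nat.log 2 n ≤ n := by exact_mod_cast Nat.pow_log_le_self 2 (by omega)
    linarith
  have hnot := hi₀ (m - m₀) (by omega)
  rw [Nat.sub_add_cancel (by omega)] at hnot
  simp only [hD, Set.mem_ofPred_eq, not_exists, not_and, not_lt] at hnot
  have hlogn : 0 ≤ Real.log n := Real.log_natCast_nonneg n
  rw [norm_norm, Real.norm_eq_abs, abs_of_nonneg (by positivity)]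
  calc _ ≤ 3 * (√(2 ^ m) * m) := hnot n hnm
    _ ≤ 3 * (√(2 * n) * (4 * Real.log n)) := by
        gcongr
        rw [hm]
        push_cast
        exact natLog_two_add_one_le hn2
    _ = _ := by rw [Real.sqrt_mul zero_le_two]; ring

lemma ae_isBigO_norm_sum (hW : IsGeometricallyMixing P W a r) {f : G → F}
    (hf : StronglyMeasurable f) {K : ℝ} (hfK : ∀ x, ‖f x‖ ≤ K) :
    ∀ᵐ ω ∂P, (fun n : ℕ => ‖∑ t ∈ Finset.range n, (f (W t ω) - ∫ x, f x ∂(P.map (W 0)))‖)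
      =O[atTop] fun n : ℕ => √n * Real.log n := by
  have := hW.isProbabilityMeasure_map
  set ν := P.map (W 0)
  have hK0 : 0 ≤ K := by
    obtain ⟨x⟩ := ν.nonempty_of_neZero
    exact (norm_nonneg _).trans (hfK x)
  have hfi : Integrable f ν := .of_bound hf.aestronglyMeasurable K (.of_forall hfK)
  refine hW.ae_isBigO_norm_sum_of_centered (f := fun x => f x - ∫ x, f x ∂ν)
    (hf.sub stronglyMeasurable_const) (K := K + K + 1) (by positivity) (fun x => ?_) ?_
  · refine (norm_sub_le _ _).trans ?_
    have : ‖∫ x, f x ∂ν‖ ≤ K := by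
      simpa using norm_integral_le_of_norm_le_const (μ := ν) (.of_forall hfK)
    linarith [hfK x]
  · rw [integral_sub hfi (integrable_const _)]
    simp [ν]

end IsGeometricallyMixing

end AlmostSureRate

/-! ### Mixing of stationary processes -/

section Stationarity

variable {Ω E : Type*} [mΩ : MeasurableSpace Ω] [MeasurableSpace E] {P : Measure Ω}
  [IsProbabilityMeasure P] {X : ℤ → Ω → E}

omit [IsProbabilityMeasure P] in
lemma IsStationary.map_pair_eq (hstat : IsStationary X P) (hX : ∀ t, Measurable (X t)) (η t : ℕ) :
    P.map (fun ω => (X t ω, X (t + η) ω)) = P.map (fun ω => (X 0 ω, X η ω)) := by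
  have h := hstat 2 ![0, η] t
  have hmap := congrArg (Measure.map fun v : Fin 2 → E => (v 0, v 1)) h
  rw [Measure.map_map (by fun_prop) (measurable_pi_lambda _ fun i => hX _),
    Measure.map_map (by fun_prop) (measurable_pi_lambda _ fun i => hX _)] at hmap
  simp only [Function.comp_def, Matrix.cons_val_zero, Matrix.cons_val_one, zero_add] at hmap
  rw [hmap]
  simp only [add_comm]

/-- Stationarity of the finite-dimensional laws gives invariance of the law of the whole path. -/
lemma IsStationary.map_shift_eq (hstat : IsStationary X P) (hX : ∀ t, Measurable (X t)) (N : ℕ) :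
    P.map (fun ω t => X (t - N) ω) = P.map (fun ω t => X t ω) := by
  refine (ProbabilityTheory.map_eq_iff_forall_finset_map_restrict_eq
    (X := fun t => X (t - N)) (Y := X)
    (measurable_pi_lambda _ fun t => hX _).aemeasurable
    (measurable_pi_lambda _ fun t => hX _).aemeasurable).2 fun I => ?_
  have h := hstat I.card (fun i => (I.equivFin.symm i : ℤ) - N) N
  have hmap := congrArg (Measure.map fun (v : Fin I.card → E) (i : I) => v (I.equivFin i)) h
  rw [Measure.map_map (measurable_pi_lambda _ fun i => measurable_pi_apply _)
      (measurable_pi_lambda _ fun i => hX _),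
    Measure.map_map (measurable_pi_lambda _ fun i => measurable_pi_apply _)
      (measurable_pi_lambda _ fun i => hX _)] at hmap
  simpa [Function.comp_def, Finset.restrict_def] using hmap

omit mΩ in
lemma sigmaField_eq_comap (X : ℤ → Ω → E) (I : Set ℤ) :
    sigmaField X I = MeasurableSpace.comap (fun ω t => X t ω)
      (⨆ t ∈ I, MeasurableSpace.comap (fun x : ℤ → E => x t) inferInstance) := by
  simp only [sigmaField, MeasurableSpace.comap_iSup, MeasurableSpace.comap_comp]
  rfl

lemma abs_measureReal_inter_sub_le_one (A B : Set Ω) :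
    |P.real (A ∩ B) - P.real A * P.real B| ≤ 1 := by
  have h1 : P.real (A ∩ B) ≤ 1 := measureReal_le_one
  have h2 : P.real A * P.real B ≤ 1 :=
    mul_le_one₀ measureReal_le_one measureReal_nonneg measureReal_le_one
  have h3 : 0 ≤ P.real (A ∩ B) := measureReal_nonneg
  have h4 : 0 ≤ P.real A * P.real B := by positivity
  rw [abs_le]
  constructor <;> linarith

lemma le_alphaCoeff {Ω : Type*} {F₁ F₂ : MeasurableSpace Ω} [MeasurableSpace Ω] {P : Measure Ω}
    [IsProbabilityMeasure P] {A B : Set Ω} (hA : MeasurableSet[F₁] A)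
    (hB : MeasurableSet[F₂] B) :
    |P.real (A ∩ B) - P.real A * P.real B| ≤ alphaCoeff P F₁ F₂ := by
  refine le_csSup ⟨1, ?_⟩ ⟨A, B, hA, hB, rfl⟩
  rintro _ ⟨A, B, -, -, rfl⟩
  exact abs_measureReal_inter_sub_le_one A B

/-- By stationarity the mixing coefficients control the dependence across a gap in any position. -/
lemma IsStationary.abs_measureReal_inter_sub_le (hstat : IsStationary X P)
    (hX : ∀ t, Measurable (X t)) (N m : ℕ) {A B : Set Ω}
    (hA : MeasurableSet[sigmaField X (Set.Iic N)] A)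
    (hB : MeasurableSet[sigmaField X (Set.Ici (N + m))] B) :
    |P.real (A ∩ B) - P.real A * P.real B| ≤ mixingCoeff X P m := by
  rw [sigmaField_eq_comap] at hA hB
  obtain ⟨A', hA', rfl⟩ := hA
  obtain ⟨B', hB', rfl⟩ := hB
  have hpi : ∀ I : Set ℤ, (⨆ t ∈ I, MeasurableSpace.comap (fun x : ℤ → E => x t) inferInstance)
      ≤ MeasurableSpace.pi := fun I => iSup₂_le fun t _ => (measurable_pi_apply t).comap_le
  have hXm : Measurable fun ω t => X t ω := measurable_pi_lambda _ fun t => hX _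
  have hYm : Measurable fun ω (t : ℤ) => X (t - N) ω := measurable_pi_lambda _ fun t => hX _
  have hlaw : ∀ S : Set (ℤ → E), MeasurableSet S → P.real ((fun ω t => X t ω) ⁻¹' S)
      = P.real ((fun ω (t : ℤ) => X (t - N) ω) ⁻¹' S) := fun S hS => by
    rw [← map_measureReal_apply hXm hS, ← map_measureReal_apply hYm hS, hstat.map_shift_eq hX N]
  rw [← Set.preimage_inter, hlaw _ (hpi _ _ hA'), hlaw _ (hpi _ _ hB'),
    hlaw _ ((hpi _ _ hA').inter (hpi _ _ hB')), Set.preimage_inter]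
  have hshift : ∀ I J : Set ℤ, (∀ t ∈ I, t - N ∈ J) → ∀ S : Set (ℤ → E),
      MeasurableSet[⨆ t ∈ I, MeasurableSpace.comap (fun x : ℤ → E => x t) inferInstance] S →
      MeasurableSet[sigmaField X J] ((fun ω (t : ℤ) => X (t - N) ω) ⁻¹' S) := by
    intro I J hIJ S hS
    have h : MeasurableSet[sigmaField (fun t => X (t - N)) I]
        ((fun ω (t : ℤ) => X (t - N) ω) ⁻¹' S) := by
      rw [sigmaField_eq_comap]
      exact ⟨S, hS, rfl⟩
    refine (?_ : sigmaField (fun t => X (t - N)) I ≤ sigmaField X J) _ h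
    exact iSup₂_le fun t ht => le_iSup₂_of_le (t - (N : ℤ)) (hIJ t ht) le_rfl
  exact le_alphaCoeff (hshift _ (Set.Iic 0) (fun t ht => by simp at ht ⊢; omega) _ hA')
    (hshift _ (Set.Ici m) (fun t ht => by simp at ht ⊢; omega) _ hB')

/-- The process of pairs `(X t, X (t + η))` is geometrically mixing. The loss of `η` in the length
of a gap is absorbed by the factor `(r ^ η)⁻¹`, and the summand `1` covers gaps shorter than `η`. -/
lemma isGeometricallyMixing_pair (hstat : IsStationary X P) (hX : ∀ t, Measurable (X t)) (η : ℕ)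
    {r a : ℝ} (hr : r ∈ Set.Ioo (0 : ℝ) 1) (ha : 0 < a)
    (hα : ∀ t : ℕ, mixingCoeff X P t ≤ a * r ^ t) :
    IsGeometricallyMixing P (fun (t : ℕ) ω => (X ((t + 1 : ℕ) : ℤ) ω, X (((t + 1 : ℕ) : ℤ) + η) ω))
      ((a + 1) * (r ^ η)⁻¹) r where
  measurable t := (hX _).prodMk (hX _)
  map_eq t := (hstat.map_pair_eq hX η (t + 1)).trans (hstat.map_pair_eq hX η (0 + 1)).symm
  const_pos := mul_pos (by linarith) (inv_pos.2 (pow_pos hr.1 _))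
  rate_pos := hr.1
  rate_lt_one := hr.2
  mixing k d A B hA hB := by
    have hr0 := hr.1
    have hmem : ∀ (J : Set ℤ) (t : ℤ), t ∈ J →
        MeasurableSpace.comap (X t) inferInstance ≤ sigmaField X J := fun J t ht =>
      le_iSup₂_of_le t ht le_rfl
    have hle : ∀ (I : Set ℕ) (J : Set ℤ), (∀ t ∈ I, ((t + 1 : ℕ) : ℤ) ∈ J) →
        (∀ t ∈ I, ((t + 1 : ℕ) : ℤ) + η ∈ J) →
        generatedField (fun (t : ℕ) ω => (X ((t + 1 : ℕ) : ℤ) ω, X (((t + 1 : ℕ) : ℤ) + η) ω)) I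
          ≤ sigmaField X J := fun I J h1 h2 => by
      refine iSup₂_le fun t ht => measurable_iff_comap_le.1 ?_
      exact Measurable.prodMk (measurable_iff_comap_le.2 (hmem J _ (h1 t ht)))
        (measurable_iff_comap_le.2 (hmem J _ (h2 t ht)))
    rcases le_or_gt η d with h | h
    · refine (hstat.abs_measureReal_inter_sub_le hX (k + 1 + η) (d - η) (A := A) (B := B)
        (hle _ _ ?_ ?_ _ hA) (hle _ _ ?_ ?_ _ hB)).trans ((hα (d - η)).trans ?_)
      any_goals
        intro t ht
        simp only [Set.mem_Iic, Set.mem_Ici] at ht ⊢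
        push_cast
        omega
      rw [pow_sub₀ r hr0.ne' h]
      calc a * (r ^ d * (r ^ η)⁻¹) ≤ (a + 1) * (r ^ d * (r ^ η)⁻¹) := by gcongr; linarith
        _ = _ := by ring
    · refine (abs_measureReal_inter_sub_le_one A B).trans ?_
      have h1 : r ^ η ≤ r ^ d := pow_le_pow_of_le_one hr0.le hr.2.le h.le
      have h2 : 0 < r ^ η := pow_pos hr0 _
      calc (1 : ℝ) ≤ (r ^ η)⁻¹ * r ^ d := by rw [← div_eq_inv_mul, one_le_div h2]; exact h1
        _ ≤ (a + 1) * ((r ^ η)⁻¹ * r ^ d) := le_mul_of_one_le_left (by positivity) (by linarith)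
        _ = _ := by ring

end Stationarity

/-! ### Measurability of the tensor product -/

section Tensor

variable {H : Type*} [NormedAddCommGroup H] [InnerProductSpace ℝ H] [CompleteSpace H]

lemma continuous_tensor : Continuous fun p : H × H => tensor p.1 p.2 := by
  let B : H →ₗ[ℝ] H →ₗ[ℝ] HilbertSchmidt H := LinearMap.mk₂ ℝ tensor
    (fun y y' x => HilbertSchmidt.toCLM_injective H <| by
      ext z; simp [tensor_apply, smul_add])
    (fun c y x => HilbertSchmidt.toCLM_injective H <| by
      ext z; simp [tensor_apply, smul_smul, mul_comm])
    (fun y x x' => HilbertSchmidt.toCLM_injective H <| by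
      ext z; simp [tensor_apply, inner_add_right, add_smul])
    (fun c y x => HilbertSchmidt.toCLM_injective H <| by
      ext z; simp [tensor_apply, inner_smul_right, mul_smul])
  exact (B.mkContinuous₂ 1 fun y x => by simp [B, norm_tensor]).continuous₂

lemma stronglyMeasurable_tensor {S : Type*} [MeasurableSpace S] {u v : S → H}
    (hu : StronglyMeasurable u) (hv : StronglyMeasurable v) :
    StronglyMeasurable fun s => tensor (u s) (v s) :=
  Continuous.comp_stronglyMeasurable (g := fun p : H × H => tensor p.1 p.2) continuous_tensor
    (hu.prodMk hv)

end Tensor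

/-! ### Empirical autocovariance operators -/

section EmpiricalAutocovariance

variable {E : Type*} {H : Type*} [NormedAddCommGroup H] [InnerProductSpace ℝ H] [CompleteSpace H]
  [RKHS ℝ H E ℝ]

variable (H) in
/-- The observable `(x, y) ↦ φ(y) ⊗ φ(x)` whose time averages along `(X t, X (t + η))` are the
empirical autocovariance operators. -/
noncomputable def featureTensor (p : E × E) : HilbertSchmidt H := tensor (feature H p.2) (feature H p.1)

lemma stronglyMeasurable_featureTensor [MeasurableSpace E] [TopologicalSpace.SeparableSpace H]
    [MeasurableSpace H] [BorelSpace H] (hφ : Measurable (feature H : E → H)) :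
    StronglyMeasurable (featureTensor H : E × E → HilbertSchmidt H) := by
  have := UniformSpace.secondCountable_of_separable H
  exact stronglyMeasurable_tensor (hφ.stronglyMeasurable.comp_measurable measurable_snd)
    (hφ.stronglyMeasurable.comp_measurable measurable_fst)

lemma norm_featureTensor_le {K : ℝ} (hK : ∀ x : E, kernel H x x ≤ K) (p : E × E) :
    ‖featureTensor H p‖ ≤ K := by
  have h : ∀ x : E, ‖feature H x‖ ^ 2 ≤ K := fun x => by
    rw [← real_inner_self_eq_norm_sq, ← kernel_eq_inner]
    exact hK x
  rw [featureTensor, norm_tensor]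
  nlinarith [h p.1, h p.2, sq_nonneg (‖feature H p.2‖ - ‖feature H p.1‖)]

lemma norm_empAutocov_sub {Ω : Type*} [MeasurableSpace Ω] (P : Measure Ω) (X : ℤ → Ω → E) (η : ℕ)
    {n : ℕ} (hn : 1 ≤ n) (ω : Ω) :
    ‖empAutocov H X η n ω - autocov H P X η‖ = (n : ℝ)⁻¹ *
      ‖∑ t ∈ Finset.range n, (featureTensor H (X ((t + 1 : ℕ) : ℤ) ω, X (((t + 1 : ℕ) : ℤ) + η) ω)
        - autocov H P X η)‖ := by
  have hn0 : (n : ℝ) ≠ 0 := by positivity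
  have hIcc : Finset.Icc 1 n = (Finset.range n).map (addRightEmbedding 1) := by
    ext t
    simp only [Finset.mem_Icc, Finset.mem_map, Finset.mem_range, addRightEmbedding_apply]
    exact ⟨fun h => ⟨t - 1, by omega, by omega⟩, by rintro ⟨s, hs, rfl⟩; omega⟩
  have e : empAutocov H X η n ω - autocov H P X η = (n : ℝ)⁻¹ •
      ∑ t ∈ Finset.range n, (featureTensor H (X ((t + 1 : ℕ) : ℤ) ω, X (((t + 1 : ℕ) : ℤ) + η) ω)
        - autocov H P X η) := by
    rw [Finset.sum_sub_distrib, smul_sub, Finset.sum_const, Finset.card_range,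
      ← Nat.cast_smul_eq_nsmul ℝ, inv_smul_smul₀ hn0, empAutocov, hIcc, Finset.sum_map]
    rfl
  rw [e, norm_smul, norm_inv, Real.norm_natCast]

lemma exp_neg_mul_sqrt_le {k : ℝ} (hk : 0 < k) {n : ℕ} (hn : 1 ≤ n) :
    Real.exp (-k * √n) ≤ Real.exp (-k * (n : ℝ) ^ (1 / 3 : ℝ)) := by
  rw [neg_mul, neg_mul, Real.sqrt_eq_rpow]
  gcongr
  · exact_mod_cast hn
  · norm_num

lemma isBigO_sqrt_mul_log : (fun n : ℕ => (n : ℝ)⁻¹ * (√n * Real.log n)) =O[atTop]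
    fun n : ℕ => Real.log n ^ (3 / 2 : ℝ) / (n : ℝ) ^ (1 / 2 : ℝ) := by
  have hlog : Tendsto (fun n : ℕ => Real.log n) atTop atTop :=
    Real.tendsto_log_atTop.comp tendsto_natCast_atTop_atTop
  refine IsBigO.of_bound 1 ?_
  filter_upwards [hlog.eventually_ge_atTop 1, eventually_ge_atTop 1] with n h1 hn
  have hn0 : (0 : ℝ) < n := by exact_mod_cast hn
  have hl0 : 0 ≤ Real.log n := by linarith
  rw [one_mul, Real.norm_eq_abs, abs_of_nonneg (by positivity), Real.norm_eq_abs,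
    abs_of_nonneg (by positivity), ← Real.sqrt_eq_rpow]
  have e : (n : ℝ)⁻¹ * (√n * Real.log n) = Real.log n / √n := by
    have hs : √(n : ℝ) ≠ 0 := (Real.sqrt_pos.2 hn0).ne'
    field_simp
    rw [Real.sq_sqrt hn0.le]
  rw [e]
  gcongr
  exact Real.self_le_rpow_of_one_le h1 (by norm_num)

end EmpiricalAutocovariance

end KernelAutocov

open KernelAutocov in
theorem mainTheorem6
    {Ω : Type*} [MeasurableSpace Ω] (P : Measure Ω) [IsProbabilityMeasure P]
    {E : Type*} [TopologicalSpace E] [PolishSpace E] [MeasurableSpace E] [BorelSpace E]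
    {H : Type*} [NormedAddCommGroup H] [InnerProductSpace ℝ H] [CompleteSpace H]
    [TopologicalSpace.SeparableSpace H] [MeasurableSpace H] [BorelSpace H] [RKHS ℝ H E ℝ]
    (hφ : Measurable (feature H : E → H))
    (hk : BddAbove (Set.range fun x : E => kernel H x x))
    (X : ℤ → Ω → E) (hX : ∀ t, Measurable (X t))
    (hstat : IsStationary X P) (hmix : IsAlphaMixing X P)
    (η : ℕ) (l : ℕ → ℝ) (hl : IsEigenvalueSequence (covOp H P X η) l)
    (r a : ℝ) (hr : r ∈ Set.Ioo (0 : ℝ) 1) (ha : 0 < a)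
    (hα : ∀ t : ℕ, mixingCoeff X P t ≤ a * r ^ t)
    (hdecay : ∀ j : ℕ, l j < a * r ^ j) :
    (∀ ε : ℝ, 0 < ε → ∃ k₁ k₂ : ℝ, 0 < k₁ ∧ 0 < k₂ ∧ ∀ n : ℕ, 1 ≤ n →
      P.real {ω | ε < ‖empAutocov H X η n ω - autocov H P X η‖}
        ≤ k₁ * Real.exp (-k₂ * (n : ℝ) ^ (1 / 3 : ℝ))) ∧
    ∀ᵐ ω ∂P, (fun n : ℕ => ‖empAutocov H X η n ω - autocov H P X η‖) =O[atTop]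
      fun n : ℕ => Real.log n ^ (3 / 2 : ℝ) / (n : ℝ) ^ (1 / 2 : ℝ) := by
  obtain ⟨K, hK⟩ := hk
  have hbound := norm_featureTensor_le (H := H) (fun x : E => hK ⟨x, rfl⟩)
  have hmeas := stronglyMeasurable_featureTensor hφ
  have hW := isGeometricallyMixing_pair hstat hX η hr ha hα
  have hmean : ∫ p, featureTensor H p ∂(P.map fun ω =>
      (X ((0 + 1 : ℕ) : ℤ) ω, X (((0 + 1 : ℕ) : ℤ) + η) ω)) = autocov H P X η := by
    rw [hstat.map_pair_eq hX η (0 + 1),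
      integral_map ((hX _).prodMk (hX _)).aemeasurable hmeas.aestronglyMeasurable]
    rfl
  refine ⟨fun ε hε => ?_, ?_⟩
  · obtain ⟨k₁, k₂, h1, h2, h⟩ := hW.isExpSmall_norm_sum hmeas hbound hε
    refine ⟨k₁, k₂, h1, h2, fun n hn => le_trans ?_
      ((h n hn).trans (mul_le_mul_of_nonneg_left (exp_neg_mul_sqrt_le h2 hn) h1.le))⟩
    refine measureReal_mono (fun ω hω => ?_) (measure_ne_top _ _)
    have hn0 : (0 : ℝ) < n := by exact_mod_cast hn
    simp only [Set.mem_ofPred_eq] at hω ⊢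
    rw [norm_empAutocov_sub P X η hn, inv_mul_eq_div, lt_div_iff₀ hn0] at hω
    rw [hmean]
    linarith
  · filter_upwards [hW.ae_isBigO_norm_sum hmeas hbound] with ω hω
    rw [hmean] at hω
    refine (IsBigO.congr' ((isBigO_refl (fun n : ℕ => (n : ℝ)⁻¹) atTop).mul hω) ?_
      .rfl).trans isBigO_sqrt_mul_log
    filter_upwards [eventually_ge_atTop 1] with n hn
    exact (norm_empAutocov_sub P X η hn ω).symm
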